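/- Let $F\subseteq\mathbb R$ be a subfield and $\Phi$ a finite, not necessarily crystallographic, root system whose coroots take values in $F$ on the roots. Let $B$ be a basis of $\Phi$ (linearly independent, and every root is a combination of $B$ with all coefficients $\ge 0$ or all $\le 0$). Let $\Lambda$ be a totally ordered abelian group that is an ordered $F$-vector space. The model space is $\mathbb A=\mathrm{span}_F(\Phi)\otimes_F\Lambda$. The spherical Weyl group $\overline W$ acts on $\mathbb A$ through the first factor, and each coroot gives a map $\alpha^\vee:\mathbb A\to\Lambda$. Let $T\le\mathbb A$ be a $\overline W$-invariant subgroup and $W_T=\overline W\ltimes T$. Let $C_f=\{x\in\mathbb A:\alpha^\vee(x)\ge 0 \text{ for all }\alpha\in B\}$. The Weyl chambers of $\mathbb A$ are the sets $p+wC_f$ ($p\in\mathbb A$, $w\in\overline W$); $p$ is the base point, and $p-wC_f$ is opposite to $p+wC_f$. Equip $\mathbb A$ with the $\overline W$-invariant $\Lambda$-metric $d(x,y)=\sum_{\alpha\in\Phi}|\alpha^\vee(x-y)|$. A set $Y\subseteq\mathbb A$ is convex if for all $x,y\in Y$ it contains $\{z: d(x,y)=d(x,z)+d(z,y)\}$;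 closed means closed in the topology of $d$. Let $X$ be a set and $\mathcal A$ a set of injective maps (charts) $f:\mathbb A\to X$ whose images cover $X$. The images of the charts are the apartments, and the images of Weyl chambers under charts are the Weyl chambers of $X$, based at the images of their base points. A sub-Weyl chamber of a Weyl chamber $S$ is a Weyl chamber contained in $S$. For $\varepsilon>0$ in $\Lambda$ let $B_\varepsilon(x)$ be the set of the $y\in X$ for which there are $f\in\mathcal A$ and $p,q\in\mathbb A$ with $f(p)=x$, $f(q)=y$, $d(p,q)<\varepsilon$. Two Weyl chambers $S,S'$ based at $x$ have the same germ at $x$ if $S\cap B_\varepsilon(x)\subseteq S'$ and $S'\cap B_\varepsilon(x)\subseteq S$ for some $\varepsilon>0$. The germ of $S$ at its base point $x$ is contained in $Y\subseteq X$ if $S\cap B_\varepsilon(x)\subseteq Y$ for some $\varepsilon>0$. The germs at $x$ of $S,S'$ are opposite if there are $f\in\mathcal A$, $p\in\mathbb A$, $w\in\overline W$ with $f(p)=x$ such that $S$ has the same germ at $x$ as $f(p+wC_f)$ and $S'$ has the same germ at $x$ as $f(p-wC_f)$. Consider the following properties. - (A1) If $f\in\mathcal A$ and $u\in W_T$, then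 $f\circ u\in\mathcal A$. - (A2) If $f,g\in\mathcal A$ and $f(\mathbb A)\cap g(\mathbb A)\ne\emptyset$, then $f^{-1}(g(\mathbb A))$ is closed and convex, and there is $u\in W_T$ such that $f=g\circ u$ on $f^{-1}(g(\mathbb A))$. - (A3) Any two points of $X$ lie in a common apartment. - (A3') Any two germs of Weyl chambers are contained in a common apartment. - (GG) Any two germs of Weyl chambers based at the same point are contained in a common apartment. - (CO) Any two Weyl chambers based at the same point $x$ whose germs at $x$ are opposite are contained in a unique common apartment. - (A4) Any two Weyl chambers of $X$ have sub-Weyl chambers that are contained in a common apartment. Assume (A1) and (A2). Then the conditions "(A3), (GG) and (CO)" and "(A3') and (CO)" are equivalent, and each of them implies (A4). -/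

import Mathlib

open scoped TensorProduct

namespace AffineBuilding

noncomputable section

/-! ### The model space -/

section Model

variable {F : Subfield ℝ} {ι M N : Type*} [AddCommGroup M] [Module F M]
  [AddCommGroup N] [Module F N]

/-- `B` is a basis of the root system: its roots are linearly independent and every root is a
linear combination of them with all coefficients `≥ 0` or with all coefficients `≤ 0`. -/
def IsRootBasis (P : RootPairing ι F M N) (B : Finset ι) : Prop :=
  LinearIndepOn F P.root (B : Set ι) ∧
    ∀ i, ∃ c : ι → F, P.root i = ∑ j ∈ B, c j • P.root j ∧
      ((∀ j ∈ B, 0 ≤ c j) ∨ (∀ j ∈ B, c j ≤ 0))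

variable (Λ : Type*) [AddCommGroup Λ] [Module F Λ]

/-- The model space `span_F(Φ) ⊗_F Λ`, where `M` is the `F`-span of the root system `Φ`. -/
abbrev ModelSpace (_P : RootPairing ι F M N) : Type _ := M ⊗[F] Λ

/-- The evaluation `α_i^∨ : span_F(Φ) ⊗_F Λ → Λ` of a coroot, `v ⊗ a ↦ α_i^∨(v) • a`. -/
def corootEval (P : RootPairing ι F M N) (i : ι) : ModelSpace Λ P →ₗ[F] Λ :=
  (TensorProduct.lid F Λ).toLinearMap ∘ₗ (P.coroot' i).rTensor Λ

/-- The spherical Weyl group, acting on the model space: it is generated by the reflections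
`s_α ⊗ id`. -/
def sphericalWeyl (P : RootPairing ι F M N) : Subgroup (ModelSpace Λ P ≃ₗ[F] ModelSpace Λ P) :=
  Subgroup.closure (Set.range fun i => (P.reflection i).rTensor Λ)

variable {Λ}

/-- `T` is invariant under the spherical Weyl group. -/
def IsWeylInvariant (P : RootPairing ι F M N) (T : AddSubgroup (ModelSpace Λ P)) : Prop :=
  ∀ w ∈ sphericalWeyl Λ P, ∀ t ∈ T, w t ∈ T

/-- The elements `x ↦ t + w x` of the affine Weyl group, the semidirect product of the spherical
Weyl group with the translation group `T`, as self-maps of the model space. -/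
def affineWeyl (P : RootPairing ι F M N) (T : AddSubgroup (ModelSpace Λ P)) :
    Set (ModelSpace Λ P → ModelSpace Λ P) :=
  {u | ∃ t ∈ T, ∃ w ∈ sphericalWeyl Λ P, u = fun x => t + w x}

variable [LinearOrder Λ]

/-- The (closed) fundamental Weyl chamber of the basis `B`. -/
def fundChamber (P : RootPairing ι F M N) (B : Finset ι) : Set (ModelSpace Λ P) :=
  {x | ∀ j ∈ B, 0 ≤ corootEval Λ P j x}

/-- The Weyl chamber `p + w C_f` of the model space, based at `p`. -/
def chamber (P : RootPairing ι F M N) (B : Finset ι) (p : ModelSpace Λ P)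
    (w : ModelSpace Λ P ≃ₗ[F] ModelSpace Λ P) : Set (ModelSpace Λ P) :=
  {x | ∃ c ∈ fundChamber P B, x = p + w c}

/-- The Weyl chamber `p - w C_f`, opposite to `p + w C_f` in the model space. -/
def oppChamber (P : RootPairing ι F M N) (B : Finset ι) (p : ModelSpace Λ P)
    (w : ModelSpace Λ P ≃ₗ[F] ModelSpace Λ P) : Set (ModelSpace Λ P) :=
  {x | ∃ c ∈ fundChamber P B, x = p - w c}

variable [Fintype ι]

/-- The natural Weyl-invariant `Λ`-metric on the model space, `∑_α |α^∨(x - y)|`.  The sum runs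
over all roots (in a reduced root system this is twice the sum over the positive roots). -/
def modelDist (P : RootPairing ι F M N) (x y : ModelSpace Λ P) : Λ :=
  ∑ i, |corootEval Λ P i (x - y)|

/-- The segment of `x` and `y`. -/
def modelSeg (P : RootPairing ι F M N) (x y : ModelSpace Λ P) : Set (ModelSpace Λ P) :=
  {z | modelDist P x y = modelDist P x z + modelDist P z y}

/-- Convexity: closure under segments. -/
def IsModelConvex (P : RootPairing ι F M N) (Y : Set (ModelSpace Λ P)) : Prop :=
  ∀ x ∈ Y, ∀ y ∈ Y, modelSeg P x y ⊆ Y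

/-- Closedness in the topology of the `Λ`-metric: every point outside `Y` is the centre of a ball
that misses `Y`. -/
def IsModelClosed (P : RootPairing ι F M N) (Y : Set (ModelSpace Λ P)) : Prop :=
  ∀ x ∉ Y, ∃ ε : Λ, 0 < ε ∧ ∀ y, modelDist P x y < ε → y ∉ Y

end Model

/-! ### Spaces modelled on the model space -/

section Space

variable {F : Subfield ℝ} {ι M N : Type*} [Fintype ι] [AddCommGroup M] [Module F M]
  [AddCommGroup N] [Module F N]
  {Λ : Type*} [AddCommGroup Λ] [LinearOrder Λ] [Module F Λ] {X : Type*}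

/-- `(X, A)` is a space modelled on the model space: the charts in `A` are injective and their
images cover `X`. -/
def IsModeled (P : RootPairing ι F M N) (A : Set (ModelSpace Λ P → X)) : Prop :=
  (∀ f ∈ A, Function.Injective f) ∧ ∀ x : X, ∃ f ∈ A, x ∈ Set.range f

/-- The apartments are the images of the charts. -/
def IsApartment (P : RootPairing ι F M N) (A : Set (ModelSpace Λ P → X)) (Y : Set X) : Prop :=
  ∃ f ∈ A, Y = Set.range f

/-- `S` is a Weyl chamber of `X` based at `x`. Every point of an apartment is the base point of
Weyl chambers. -/
def IsChamberAt (P : RootPairing ι F M N) (B : Finset ι) (A : Set (ModelSpace Λ P → X))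
    (x : X) (S : Set X) : Prop :=
  ∃ f ∈ A, ∃ p, f p = x ∧ ∃ w ∈ sphericalWeyl Λ P, S = f '' chamber P B p w

/-- `S` is a Weyl chamber of `X`. -/
def IsChamber (P : RootPairing ι F M N) (B : Finset ι) (A : Set (ModelSpace Λ P → X))
    (S : Set X) : Prop :=
  ∃ x, IsChamberAt P B A x S

/-- The ball `B_ε(x)` in `X`: the distance of two points of `X` is the distance of their preimages
under a chart of an apartment that contains both. -/
def ball (P : RootPairing ι F M N) (A : Set (ModelSpace Λ P → X)) (x : X) (ε : Λ) : Set X :=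
  {y | ∃ f ∈ A, ∃ p q, f p = x ∧ f q = y ∧ modelDist P p q < ε}

/-- The sets `S` and `S'` (in use: Weyl chambers based at `x`) share the same germ at `x`: their
intersection is a neighbourhood of `x` in each of them. -/
def SameGerm (P : RootPairing ι F M N) (A : Set (ModelSpace Λ P → X)) (x : X)
    (S S' : Set X) : Prop :=
  ∃ ε : Λ, 0 < ε ∧ S ∩ ball P A x ε ⊆ S' ∧ S' ∩ ball P A x ε ⊆ S

/-- The germ of `S` at `x` is contained in the set `Y`. -/
def GermIn (P : RootPairing ι F M N) (A : Set (ModelSpace Λ P → X)) (x : X)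
    (S Y : Set X) : Prop :=
  ∃ ε : Λ, 0 < ε ∧ S ∩ ball P A x ε ⊆ Y

/-- The germs of `S` and `S'` at `x` are opposite chambers of the residue at `x`: they lie in a
common apartment of the residue (the apartments of the residue are the sets of germs at `x` of the
Weyl chambers in an apartment of `X` through `x`), and they are opposite in this apartment. -/
def OppositeAt (P : RootPairing ι F M N) (B : Finset ι) (A : Set (ModelSpace Λ P → X)) (x : X)
    (S S' : Set X) : Prop :=
  ∃ f ∈ A, ∃ p, f p = x ∧ ∃ w ∈ sphericalWeyl Λ P,
    SameGerm P A x S (f '' chamber P B p w) ∧ SameGerm P A x S' (f '' oppChamber P B p w)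

/-- (A1) The atlas is invariant under precomposition with the affine Weyl group. -/
def A1 (P : RootPairing ι F M N) (T : AddSubgroup (ModelSpace Λ P))
    (A : Set (ModelSpace Λ P → X)) : Prop :=
  ∀ f ∈ A, ∀ u ∈ affineWeyl P T, f ∘ u ∈ A

/-- (A2) If two apartments meet, then their intersection is closed and convex in the charts, and
the charts agree there up to an element of the affine Weyl group. -/
def A2 (P : RootPairing ι F M N) (T : AddSubgroup (ModelSpace Λ P))
    (A : Set (ModelSpace Λ P → X)) : Prop :=
  ∀ f ∈ A, ∀ g ∈ A, (Set.range f ∩ Set.range g).Nonempty →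
    IsModelClosed P (f ⁻¹' Set.range g) ∧ IsModelConvex P (f ⁻¹' Set.range g) ∧
      ∃ u ∈ affineWeyl P T, Set.EqOn f (g ∘ u) (f ⁻¹' Set.range g)

/-- (A3) Any two points lie in a common apartment. -/
def A3 (P : RootPairing ι F M N) (A : Set (ModelSpace Λ P → X)) : Prop :=
  ∀ x y : X, ∃ Y, IsApartment P A Y ∧ x ∈ Y ∧ y ∈ Y

/-- (A3') Any two germs of Weyl chambers are contained in a common apartment. -/
def A3' (P : RootPairing ι F M N) (B : Finset ι) (A : Set (ModelSpace Λ P → X)) : Prop :=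
  ∀ x y S S', IsChamberAt P B A x S → IsChamberAt P B A y S' →
    ∃ Y, IsApartment P A Y ∧ GermIn P A x S Y ∧ GermIn P A y S' Y

/-- (GG) Any two germs of Weyl chambers based at the same vertex are contained in a common
apartment. -/
def GG (P : RootPairing ι F M N) (B : Finset ι) (A : Set (ModelSpace Λ P → X)) : Prop :=
  ∀ x S S', IsChamberAt P B A x S → IsChamberAt P B A x S' →
    ∃ Y, IsApartment P A Y ∧ GermIn P A x S Y ∧ GermIn P A x S' Y

/-- (CO) Two Weyl chambers based at the same vertex, with opposite germs there, are contained in a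
unique common apartment. -/
def CO (P : RootPairing ι F M N) (B : Finset ι) (A : Set (ModelSpace Λ P → X)) : Prop :=
  ∀ x S S', IsChamberAt P B A x S → IsChamberAt P B A x S' → OppositeAt P B A x S S' →
    ∃! Y, IsApartment P A Y ∧ S ⊆ Y ∧ S' ⊆ Y

/-- (A4) Any two Weyl chambers have sub-Weyl chambers that are contained in a common apartment. -/
def A4 (P : RootPairing ι F M N) (B : Finset ι) (A : Set (ModelSpace Λ P → X)) : Prop :=
  ∀ S S', IsChamber P B A S → IsChamber P B A S' →
    ∃ S₁ S₁', IsChamber P B A S₁ ∧ S₁ ⊆ S ∧ IsChamber P B A S₁' ∧ S₁' ⊆ S' ∧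
      ∃ Y, IsApartment P A Y ∧ S₁ ⊆ Y ∧ S₁' ⊆ Y

end Space

end

end AffineBuilding

namespace AffineBuilding

noncomputable section

set_option linter.unusedSectionVars false

/-! ### Dual vectors of linearly independent families -/

section LinearAlgebra

/-! (A3') gives (A3) because a germ contains its base point, and it gives (GG) by taking equal base
points. The content lies in the converse and in (A4).

Two tools recur. In the model space, every coroot has constant sign on a chamber, so the metric is
additive along the chamber order and a convex set contains order intervals
(`IsModelConvex.mem_of_dominated`). In `X`, charts that coincide on one chamber germ coincide
wherever their apartments meet (`agree_of_eventually`).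

For (A3'), the key is `exists_chart_chamber_germ`: (GG) puts two germs at a point into an apartment,
and (CO) replaces it by one that contains a whole chamber and is unchanged near the point. A chamber
based at one point and reaching the other point, or the germ there, then carries the data along; two
applications suffice.

For (A4), `exists_opp_chamber` finds, in any apartment through the base point of a chamber, a
chamber opposite to it. Hence a point shares an apartment with a subchamber of any given chamber
(`exists_chart_subchamber_point`). Applied to the points of a ray in the second chamber, this yields
apartments that are determined by a pair of Weyl group elements, by the uniqueness in (CO). The Weyl
group is finite, so one apartment serves arbitrarily far points of the ray, and convexity gives a
subchamber. -/

theorem exists_dual_of_linearIndepOn {K E κ : Type*} [Field K] [AddCommGroup E] [Module K E]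
    {v : κ → E} {s : Set κ} (h : LinearIndepOn K v s) (a : κ → K) :
    ∃ ψ : Module.Dual K E, ∀ j ∈ s, ψ (v j) = a j := by
  obtain ⟨g, hg⟩ := LinearMap.exists_extend
    ((Finsupp.linearCombination K fun j : s => a j) ∘ₗ (LinearIndependent.repr h))
  refine ⟨g, fun j hj => ?_⟩
  have hmem : v j ∈ Submodule.span K (Set.range fun x : s => v x) :=
    Submodule.subset_span ⟨⟨j, hj⟩, rfl⟩
  have h1 := LinearMap.congr_fun hg ⟨v j, hmem⟩
  have h2 : LinearIndependent.repr h ⟨v j, hmem⟩ = Finsupp.single ⟨j, hj⟩ 1 :=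
    LinearIndependent.repr_eq_single h ⟨j, hj⟩ _ rfl
  simpa [h2] using h1

end LinearAlgebra

/-! ### The Weyl group action on the model space and on the coroots. -/

section Model

variable {F : Subfield ℝ} {ι M N : Type*} [AddCommGroup M] [Module F M]
  [AddCommGroup N] [Module F N] {Λ : Type*} [AddCommGroup Λ] [Module F Λ]

@[simp]
theorem corootEval_tmul (P : RootPairing ι F M N) (i : ι) (m : M) (a : Λ) :
    corootEval Λ P i (m ⊗ₜ a) = P.coroot' i m • a := by
  simp [corootEval]

/-- A Weyl group element comes from an automorphism of the root system. -/
theorem sphericalWeyl_exists_equiv (P : RootPairing ι F M N) (w : sphericalWeyl Λ P) :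
    ∃ (φ : M ≃ₗ[F] M) (σ : Equiv.Perm ι), (∀ m (a : Λ), w • (m ⊗ₜ[F] a) = φ m ⊗ₜ a) ∧
      (∀ i, φ (P.root i) = P.root (σ i)) ∧
      ∀ i m, P.coroot' i (φ m) = P.coroot' (σ⁻¹ i) m := by
  obtain ⟨w, hw⟩ := w
  simp only [Subgroup.mk_smul, LinearEquiv.smul_def]
  induction hw using Subgroup.closure_induction with
  | mem x hx =>
    obtain ⟨i, rfl⟩ := hx
    refine ⟨P.reflection i, P.reflectionPerm i, ?_, ?_, ?_⟩
    · intro m a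
      simp
    · intro j
      rw [P.root_reflectionPerm]
    · intro j m
      rw [P.coroot'_reflection]
      simp
  | one => exact ⟨.refl F M, 1, by simp, by simp, by simp⟩
  | mul x y _ _ hx hy =>
    obtain ⟨φ, σ, h1, h2, h3⟩ := hx
    obtain ⟨φ', σ', h1', h2', h3'⟩ := hy
    refine ⟨φ'.trans φ, σ * σ', ?_, ?_, ?_⟩
    · intro m a
      simp [h1, h1']
    · intro i
      simp [h2, h2']
    · intro i m
      simp [h3, h3', mul_inv_rev]
  | inv x _ hx =>
    obtain ⟨φ, σ, h1, h2, h3⟩ := hx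
    refine ⟨φ.symm, σ⁻¹, ?_, ?_, ?_⟩
    · intro m a
      have := h1 (φ.symm m) a
      rw [LinearEquiv.apply_symm_apply] at this
      rw [← this]
      exact x.symm_apply_apply _
    · intro i
      rw [LinearEquiv.symm_apply_eq, h2]
      simp
    · intro i m
      have := h3 (σ i) (φ.symm m)
      simpa using this.symm

theorem sphericalWeyl_ext (P : RootPairing ι F M N) {w w' : sphericalWeyl Λ P}
    (h : ∀ (m : M) (a : Λ), w • (m ⊗ₜ[F] a) = w' • (m ⊗ₜ[F] a)) : w = w' := by
  apply Subtype.ext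
  apply LinearEquiv.toLinearMap_injective
  exact TensorProduct.ext' h

/-- The roots span `M`, so an element is determined by its permutation of the finitely many roots.
This finiteness drives the extremal and pigeonhole arguments below. -/
instance sphericalWeyl_finite (P : RootPairing ι F M N) [P.IsRootSystem] [Finite ι] :
    Finite (sphericalWeyl Λ P) := by
  choose φ σ h1 h2 h3 using sphericalWeyl_exists_equiv (Λ := Λ) P
  refine Finite.of_injective σ fun w w' h => sphericalWeyl_ext P fun m a => ?_
  rw [h1, h1]
  congr 1
  have hm : m ∈ Submodule.span F (Set.range P.root) := by
    have := RootPairing.IsRootSystem.span_root_eq_top (P := P)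
    rw [this]; trivial
  have : Set.EqOn (φ w : M →ₗ[F] M) (φ w' : M →ₗ[F] M) (Set.range P.root) := by
    rintro _ ⟨i, rfl⟩
    simp [h2, h]
  exact LinearMap.eqOn_span this hm

theorem corootEval_smul_perm (P : RootPairing ι F M N) (w : sphericalWeyl Λ P) :
    ∃ σ : Equiv.Perm ι, ∀ i (x : ModelSpace Λ P),
      corootEval Λ P i (w • x) = corootEval Λ P (σ i) x := by
  obtain ⟨φ, σ, h1, -, h3⟩ := sphericalWeyl_exists_equiv P w
  refine ⟨σ⁻¹, fun i x => ?_⟩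
  induction x using TensorProduct.induction_on with
  | zero => simp
  | tmul m a => rw [h1, corootEval_tmul, h3, corootEval_tmul]
  | add x y hx hy => rw [smul_add, map_add, map_add, hx, hy]

/-- The reflection in a root, as an element of the Weyl group. -/
def weylReflection (Λ : Type*) [AddCommGroup Λ] [Module F Λ] (P : RootPairing ι F M N) (i : ι) :
    sphericalWeyl Λ P :=
  ⟨(P.reflection i).rTensor Λ, Subgroup.subset_closure ⟨i, rfl⟩⟩

theorem weylReflection_smul (P : RootPairing ι F M N) (i : ι) (x : ModelSpace Λ P) :
    weylReflection Λ P i • x = x - P.root i ⊗ₜ corootEval Λ P i x := by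
  change (P.reflection i).rTensor Λ x = _
  induction x using TensorProduct.induction_on with
  | zero => simp
  | tmul m a =>
    rw [corootEval_tmul, LinearEquiv.rTensor_tmul, P.reflection_apply, TensorProduct.sub_tmul,
      TensorProduct.smul_tmul]
  | add x y hx hy =>
    rw [map_add, map_add, hx, hy, TensorProduct.tmul_add]
    abel

theorem weylReflection_smul_of_eq_zero (P : RootPairing ι F M N) {i : ι} {x : ModelSpace Λ P}
    (h : corootEval Λ P i x = 0) : weylReflection Λ P i • x = x := by
  rw [weylReflection_smul, h, TensorProduct.tmul_zero, sub_zero]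

end Model

/-! ### Bases of the root system -/

section Basis

variable {F : Subfield ℝ} {ι M N : Type*} [Fintype ι] [AddCommGroup M] [Module F M]
  [AddCommGroup N] [Module F N]

/-- Under the polarization by the positive definite root form, coroots are positive multiples of
roots, so a sign pattern for roots passes to coroots with coefficients rescaled by norms. -/
theorem IsRootBasis.coroot_combination {P : RootPairing ι F M N} [P.IsRootSystem] {B : Finset ι}
    (hB : IsRootBasis P B) (i : ι) :
    ∃ c : ι → F, P.coroot' i = ∑ j ∈ B, c j • P.coroot' j ∧
      ((∀ j ∈ B, 0 ≤ c j) ∨ (∀ j ∈ B, c j ≤ 0)) := by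
  obtain ⟨c, hc, hsign⟩ := hB.2 i
  have hpos : ∀ k, 0 < P.RootForm (P.root k) (P.root k) := fun k =>
    P.rootForm_pos_of_ne_zero (Submodule.subset_span ⟨k, rfl⟩) (P.ne_zero k)
  set n : ι → F := fun k => P.RootForm (P.root k) (P.root k) with hn
  have key : P.coroot i = ∑ j ∈ B, (c j * n j / n i) • P.coroot j := by
    simp only [P.coroot_eq_polarizationEquiv_apply_root]
    rw [congrArg P.PolarizationEquiv hc, map_sum, Finset.smul_sum]
    refine Finset.sum_congr rfl fun j _ => ?_
    rw [map_smul, smul_smul, smul_smul]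
    congr 1
    have h1 := (hpos i).ne'
    have h2 := (hpos j).ne'
    simp only [hn]
    field_simp
  refine ⟨fun j => c j * n j / n i, ?_, ?_⟩
  · simp only [RootPairing.coroot', key, map_sum, map_smul]
  · refine hsign.imp (fun h j hj => ?_) fun h j hj => ?_
    · exact div_nonneg (mul_nonneg (h j hj) (hpos j).le) (hpos i).le
    · exact div_nonpos_of_nonpos_of_nonneg
        (mul_nonpos_of_nonpos_of_nonneg (h j hj) (hpos j).le) (hpos i).le

theorem IsRootBasis.exists_coroot_eq {P : RootPairing ι F M N} [P.IsRootSystem] {B : Finset ι}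
    (hB : IsRootBasis P B) (a : ι → F) : ∃ m : M, ∀ j ∈ B, P.coroot' j m = a j := by
  have h : LinearIndepOn F P.coroot (B : Set ι) := P.linearIndepOn_coroot_iff.2 hB.1
  obtain ⟨ψ, hψ⟩ := exists_dual_of_linearIndepOn h a
  refine ⟨P.toPerfPair.symm ψ, fun j hj => ?_⟩
  rw [← hψ j hj]
  change (P.toPerfPair (P.toPerfPair.symm ψ)) (P.coroot j) = _
  rw [LinearEquiv.apply_symm_apply]

end Basis

/-! ### The fundamental chamber as a cone, its metric and its Weyl translates. -/

section Chambers

open Filter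

variable {F : Subfield ℝ} {ι M N : Type*} [Fintype ι] [AddCommGroup M] [Module F M]
  [AddCommGroup N] [Module F N] {Λ : Type*} [AddCommGroup Λ] [LinearOrder Λ]
  [IsOrderedAddMonoid Λ] [Module F Λ]
  {P : RootPairing ι F M N} {B : Finset ι}

theorem zero_mem_fundChamber : (0 : ModelSpace Λ P) ∈ fundChamber P B := fun j _ => by simp

theorem add_mem_fundChamber {x y : ModelSpace Λ P} (hx : x ∈ fundChamber P B)
    (hy : y ∈ fundChamber P B) : x + y ∈ fundChamber P B := fun j hj => by
  rw [map_add]; exact add_nonneg (hx j hj) (hy j hj)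

/-! ### The metric -/

theorem modelDist_add_add (p x y : ModelSpace Λ P) :
    modelDist P (p + x) (p + y) = modelDist P x y := by
  simp [modelDist, add_sub_add_left_eq_sub]

theorem modelDist_self_add (p x : ModelSpace Λ P) : modelDist P p (p + x) = modelDist P 0 x := by
  simpa using modelDist_add_add p 0 x

theorem modelDist_smul_smul (w : sphericalWeyl Λ P) (x y : ModelSpace Λ P) :
    modelDist P (w • x) (w • y) = modelDist P x y := by
  obtain ⟨σ, hσ⟩ := corootEval_smul_perm P w
  simp only [modelDist, ← smul_sub, hσ]
  exact Equiv.sum_comp σ fun i => |corootEval Λ P i (x - y)|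

theorem modelDist_zero_smul (w : sphericalWeyl Λ P) (x : ModelSpace Λ P) :
    modelDist P 0 (w • x) = modelDist P 0 x := by
  simpa using modelDist_smul_smul w 0 x

theorem modelDist_zero (x : ModelSpace Λ P) :
    modelDist P 0 x = ∑ i, |corootEval Λ P i x| := by
  simp [modelDist]

theorem modelDist_self (x : ModelSpace Λ P) : modelDist P x x = 0 := by
  simp [modelDist]

theorem modelDist_zero_neg (x : ModelSpace Λ P) : modelDist P 0 (-x) = modelDist P 0 x := by
  simp [modelDist_zero]

theorem abs_corootEval_le_modelDist (i : ι) (x : ModelSpace Λ P) :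
    |corootEval Λ P i x| ≤ modelDist P 0 x := by
  rw [modelDist_zero]
  exact Finset.single_le_sum (f := fun i => |corootEval Λ P i x|) (fun _ _ => abs_nonneg _)
    (Finset.mem_univ i)

theorem exists_of_mem_affineWeyl {T : AddSubgroup (ModelSpace Λ P)}
    {u : ModelSpace Λ P → ModelSpace Λ P} (hu : u ∈ affineWeyl P T) :
    ∃ w : sphericalWeyl Λ P, ∀ p z, u (p + z) = u p + w • z := by
  obtain ⟨t, -, w, hw, rfl⟩ := hu
  refine ⟨⟨w, hw⟩, fun p z => ?_⟩
  simp only [map_add, Subgroup.mk_smul, LinearEquiv.smul_def, add_assoc]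

theorem surjective_of_mem_affineWeyl {T : AddSubgroup (ModelSpace Λ P)}
    {u : ModelSpace Λ P → ModelSpace Λ P} (hu : u ∈ affineWeyl P T) :
    Function.Surjective u := by
  obtain ⟨t, -, w, hw, rfl⟩ := hu
  intro x
  exact ⟨w.symm (x - t), by simp⟩

/-! ### Signs of coroots on the fundamental chamber -/

section Signs

variable [IsStrictOrderedModule F Λ] [P.IsRootSystem]

theorem corootEval_combination (hB : IsRootBasis P B) (i : ι) :
    ∃ c : ι → F, (∀ x : ModelSpace Λ P, corootEval Λ P i x = ∑ j ∈ B, c j • corootEval Λ P j x) ∧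
      (∃ j ∈ B, c j ≠ 0) ∧ ((∀ j ∈ B, 0 ≤ c j) ∨ (∀ j ∈ B, c j ≤ 0)) := by
  obtain ⟨c, hc, hsign⟩ := hB.coroot_combination i
  refine ⟨c, fun x => ?_, ?_, hsign⟩
  · induction x using TensorProduct.induction_on with
    | zero => simp
    | tmul m a => simp [hc, Finset.sum_smul, mul_smul]
    | add x y hx hy => simp only [map_add, hx, hy, smul_add, Finset.sum_add_distrib]
  -- If all coefficients vanished, the coroot would be zero, but it takes the value 2 on its own
  -- root.
  · by_contra! h
    have h2 : P.coroot' i (P.root i) = 2 := by simp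
    rw [hc, Finset.sum_congr rfl fun j hj => by rw [h j hj]] at h2
    simp at h2

theorem corootEval_sign (hB : IsRootBasis P B) (i : ι) :
    ((∀ x ∈ fundChamber (Λ := Λ) P B, 0 ≤ corootEval Λ P i x) ∧
      ∀ x : ModelSpace Λ P, (∀ j ∈ B, 0 < corootEval Λ P j x) → 0 < corootEval Λ P i x) ∨
    ((∀ x ∈ fundChamber (Λ := Λ) P B, corootEval Λ P i x ≤ 0) ∧
      ∀ x : ModelSpace Λ P, (∀ j ∈ B, 0 < corootEval Λ P j x) → corootEval Λ P i x < 0) := by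
  obtain ⟨c, hc, ⟨k, hk, hk0⟩, hs | hs⟩ := corootEval_combination (Λ := Λ) hB i
  · refine .inl ⟨fun x hx => ?_, fun x hx => ?_⟩ <;> rw [hc]
    · exact Finset.sum_nonneg fun j hj => smul_nonneg (hs j hj) (hx j hj)
    · exact Finset.sum_pos' (fun j hj => smul_nonneg (hs j hj) (hx j hj).le)
        ⟨k, hk, smul_pos ((hs k hk).lt_of_ne' hk0) (hx k hk)⟩
  · refine .inr ⟨fun x hx => ?_, fun x hx => ?_⟩ <;> rw [hc]
    · exact Finset.sum_nonpos fun j hj => smul_nonpos_of_nonpos_of_nonneg (hs j hj) (hx j hj)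
    · exact Finset.sum_neg' (fun j hj => smul_nonpos_of_nonpos_of_nonneg (hs j hj) (hx j hj).le)
        ⟨k, hk, smul_neg_of_neg_of_pos ((hs k hk).lt_of_ne hk0) (hx k hk)⟩

theorem corootEval_nonneg_of_pos (hB : IsRootBasis P B) {i : ι} {b : ModelSpace Λ P}
    (hb : ∀ j ∈ B, 0 < corootEval Λ P j b) (h : 0 ≤ corootEval Λ P i b) :
    0 < corootEval Λ P i b ∧ ∀ x ∈ fundChamber P B, 0 ≤ corootEval Λ P i x := by
  obtain h1 | h1 := corootEval_sign (Λ := Λ) hB i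
  · exact ⟨h1.2 b hb, h1.1⟩
  · exact absurd h (h1.2 b hb).not_ge

theorem corootEval_nonpos_of_neg (hB : IsRootBasis P B) {i : ι} {b : ModelSpace Λ P}
    (hb : ∀ j ∈ B, 0 < corootEval Λ P j b) (h : corootEval Λ P i b ≤ 0) :
    corootEval Λ P i b < 0 ∧ ∀ x ∈ fundChamber P B, corootEval Λ P i x ≤ 0 := by
  obtain h1 | h1 := corootEval_sign (Λ := Λ) hB i
  · exact absurd h (h1.2 b hb).not_ge
  · exact ⟨h1.2 b hb, h1.1⟩

/-- A coroot has constant sign on the chamber, and its sign at one regular point decides which. So a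
Weyl element moving one regular point into the chamber stabilizes the chamber. -/
theorem smul_mem_fundChamber_iff (hB : IsRootBasis P B) {v : sphericalWeyl Λ P}
    {b : ModelSpace Λ P} (hb : ∀ j ∈ B, 0 < corootEval Λ P j b) (hv : v • b ∈ fundChamber P B)
    (x : ModelSpace Λ P) : v • x ∈ fundChamber P B ↔ x ∈ fundChamber P B := by
  obtain ⟨σ, hσ⟩ := corootEval_smul_perm P v
  have h1 : ∀ j ∈ B, 0 < corootEval Λ P (σ j) b ∧
      ∀ x ∈ fundChamber P B, 0 ≤ corootEval Λ P (σ j) x := fun j hj =>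
    corootEval_nonneg_of_pos hB hb (by simpa [hσ] using hv j hj)
  have h2 : ∀ j ∈ B, 0 < corootEval Λ P j (v • b) := fun j hj => by
    rw [hσ]; exact (h1 j hj).1
  refine ⟨fun hx j hj => ?_, fun hx j hj => ?_⟩
  · have := (corootEval_nonneg_of_pos hB (i := σ⁻¹ j) h2 (by
      rw [hσ]; simpa using (hb j hj).le)).2 _ hx
    rw [hσ] at this
    simpa using this
  · rw [hσ]; exact (h1 j hj).2 x hx

theorem neg_smul_mem_fundChamber_iff (hB : IsRootBasis P B) {v : sphericalWeyl Λ P}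
    {b : ModelSpace Λ P} (hb : ∀ j ∈ B, 0 < corootEval Λ P j b)
    (hv : -(v • b) ∈ fundChamber P B) (x : ModelSpace Λ P) :
    -(v • x) ∈ fundChamber P B ↔ x ∈ fundChamber P B := by
  obtain ⟨σ, hσ⟩ := corootEval_smul_perm P v
  have h1 : ∀ j ∈ B, corootEval Λ P (σ j) b < 0 ∧
      ∀ x ∈ fundChamber P B, corootEval Λ P (σ j) x ≤ 0 := fun j hj =>
    corootEval_nonpos_of_neg hB hb (by simpa [hσ] using hv j hj)
  have h2 : ∀ j ∈ B, 0 < corootEval Λ P j (-(v • b)) := fun j hj => by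
    rw [map_neg, hσ]; exact neg_pos.2 (h1 j hj).1
  refine ⟨fun hx j hj => ?_, fun hx j hj => ?_⟩
  · have := (corootEval_nonpos_of_neg hB (i := σ⁻¹ j) h2 (by
      rw [map_neg, hσ]; simpa using (hb j hj).le)).2 _ hx
    rw [map_neg, hσ] at this
    simpa using this
  · rw [map_neg, hσ]; exact neg_nonneg.2 ((h1 j hj).2 x hx)

/-! ### The Weyl group acts on the chambers -/

/-- The functional sums the coordinates with respect to the basis, so subtracting a multiple of a
simple root lowers it by exactly that multiple. Its extremal points on a Weyl orbit therefore have
simple coroots of one sign. -/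
theorem exists_height (hB : IsRootBasis P B) :
    ∃ ψ : ModelSpace Λ P → Λ, ∀ j ∈ B, ∀ x, ψ (weylReflection Λ P j • x) =
      ψ x - corootEval Λ P j x := by
  obtain ⟨ψ, hψ⟩ := exists_dual_of_linearIndepOn hB.1 (fun _ => 1)
  refine ⟨(TensorProduct.lid F Λ).toLinearMap ∘ₗ ψ.rTensor Λ, fun j hj x => ?_⟩
  rw [weylReflection_smul, map_sub]
  simp [hψ j hj]

theorem exists_inv_smul_mem_fundChamber (hB : IsRootBasis P B) (x : ModelSpace Λ P) :
    ∃ w : sphericalWeyl Λ P, w⁻¹ • x ∈ fundChamber P B := by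
  obtain ⟨ψ, hψ⟩ := exists_height (Λ := Λ) hB
  obtain ⟨w, hw⟩ := Finite.exists_max fun w : sphericalWeyl Λ P => ψ (w⁻¹ • x)
  refine ⟨w, fun j hj => ?_⟩
  have := hw (w * (weylReflection Λ P j)⁻¹)
  rw [mul_inv_rev, inv_inv, mul_smul, hψ j hj] at this
  simpa using this

/-- The chambers `w C_f` and `v C_f` are opposite. -/
def Opp (B : Finset ι) (w v : sphericalWeyl Λ P) : Prop :=
  ∀ x : ModelSpace Λ P, w⁻¹ • x ∈ fundChamber P B ↔ -(v⁻¹ • x) ∈ fundChamber P B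

theorem Opp.symm {w v : sphericalWeyl Λ P} (h : Opp B w v) : Opp B v w := fun x => by
  have := h (-x)
  simpa using this.symm

theorem Opp.mul_left {w v : sphericalWeyl Λ P} (h : Opp B w v) (m : sphericalWeyl Λ P) :
    Opp B (m * w) (m * v) := fun x => by
  simpa [mul_smul] using h (m⁻¹ • x)

theorem Opp.of_mul_left {w v m : sphericalWeyl Λ P} (h : Opp B (m * w) (m * v)) : Opp B w v := by
  simpa using h.mul_left m⁻¹

theorem Opp.exists_smul_eq {w v : sphericalWeyl Λ P} (h : Opp B w v) {c : ModelSpace Λ P}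
    (hc : c ∈ fundChamber P B) : ∃ c' ∈ fundChamber P B, v • c' = -(w • c) :=
  ⟨-(v⁻¹ • w • c), (h _).1 (by simpa using hc), by simp⟩

theorem opp_of_regular (hB : IsRootBasis P B) {w v : sphericalWeyl Λ P} {b : ModelSpace Λ P}
    (hb : ∀ j ∈ B, 0 < corootEval Λ P j b) (h : -(v⁻¹ • w • b) ∈ fundChamber P B) :
    Opp B w v := fun x => by
  have := neg_smul_mem_fundChamber_iff hB (v := v⁻¹ * w) hb (by rwa [mul_smul]) (w⁻¹ • x)
  rw [← this, mul_smul, smul_inv_smul]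

end Signs

end Chambers

section Germs

open Filter

variable {F : Subfield ℝ} {ι M N : Type*} [Fintype ι] [AddCommGroup M] [Module F M]
  [AddCommGroup N] [Module F N] {Λ : Type*} [AddCommGroup Λ] [LinearOrder Λ]
  [IsOrderedAddMonoid Λ] [Module F Λ] [IsStrictOrderedModule F Λ]
  {P : RootPairing ι F M N} [P.IsRootSystem] {B : Finset ι}

/-! ### Regular points of the fundamental chamber -/

/-- The point of the fundamental chamber at which all simple coroots have the value `a`. -/
def rho (hB : IsRootBasis P B) (a : Λ) : ModelSpace Λ P :=
  (hB.exists_coroot_eq fun _ => 1).choose ⊗ₜ a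

theorem corootEval_rho (hB : IsRootBasis P B) (a : Λ) {j : ι} (hj : j ∈ B) :
    corootEval Λ P j (rho hB a) = a := by
  rw [rho, corootEval_tmul, (hB.exists_coroot_eq fun _ => 1).choose_spec j hj, one_smul]

theorem rho_mem_fundChamber (hB : IsRootBasis P B) {a : Λ} (ha : 0 ≤ a) :
    rho hB a ∈ fundChamber P B := fun j hj => by rwa [corootEval_rho hB a hj]

theorem rho_regular (hB : IsRootBasis P B) {a : Λ} (ha : 0 < a) :
    ∀ j ∈ B, 0 < corootEval Λ P j (rho hB a) := fun j hj => by rwa [corootEval_rho hB a hj]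

theorem exists_forall_add_rho_regular [Nontrivial Λ] (hB : IsRootBasis P B)
    (x : ModelSpace Λ P) :
    ∃ a₀ : Λ, 0 < a₀ ∧ ∀ a, a₀ ≤ a → ∀ j ∈ B, 0 < corootEval Λ P j (x + rho hB a) := by
  obtain ⟨ε, hε⟩ := exists_zero_lt (α := Λ)
  refine ⟨∑ j ∈ B, |corootEval Λ P j x| + ε,
    add_pos_of_nonneg_of_pos (Finset.sum_nonneg fun _ _ => abs_nonneg _) hε, fun a ha j hj => ?_⟩
  rw [map_add, corootEval_rho hB a hj]
  have h1 : |corootEval Λ P j x| ≤ ∑ j ∈ B, |corootEval Λ P j x| :=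
    Finset.single_le_sum (f := fun j => |corootEval Λ P j x|) (fun _ _ => abs_nonneg _) hj
  have h2 := neg_abs_le (corootEval Λ P j x)
  have h3 : |corootEval Λ P j x| < a := (h1.trans_lt (lt_add_of_pos_right _ hε)).trans_le ha
  exact neg_lt_iff_pos_add'.1 ((neg_lt_neg h3).trans_le h2 |> neg_lt.1)

theorem exists_add_rho_mem [Nontrivial Λ] (hB : IsRootBasis P B) (x : ModelSpace Λ P) :
    ∃ a : Λ, 0 < a ∧ x + rho hB a ∈ fundChamber P B := by
  obtain ⟨a, ha0, ha⟩ := exists_forall_add_rho_regular hB x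
  exact ⟨a, ha0, fun j hj => (ha a le_rfl j hj).le⟩

/-- Two parallel chambers contain a common chamber. -/
theorem exists_add_smul_eq [Nontrivial Λ] (hB : IsRootBasis P B) (w : sphericalWeyl Λ P)
    (p q : ModelSpace Λ P) :
    ∃ c ∈ fundChamber P B, ∃ c' ∈ fundChamber P B, p + w • c = q + w • c' := by
  obtain ⟨a, ha0, ha⟩ := exists_add_rho_mem hB (w⁻¹ • (p - q))
  refine ⟨_, rho_mem_fundChamber hB ha0.le, _, ha, ?_⟩
  rw [smul_add, smul_inv_smul]
  abel

theorem exists_opp [Nontrivial Λ] (hB : IsRootBasis P B) (w : sphericalWeyl Λ P) :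
    ∃ v, Opp B w v := by
  obtain ⟨ε, hε⟩ := exists_zero_lt (α := Λ)
  obtain ⟨v, hv⟩ := exists_inv_smul_mem_fundChamber hB (-(w • rho hB ε))
  exact ⟨v, opp_of_regular hB (rho_regular hB hε) (by simpa using hv)⟩

/-! ### Germs of chambers -/

/-- The filter of neighbourhoods of the base point in the fundamental chamber. -/
def germ (P : RootPairing ι F M N) (B : Finset ι) : Filter (ModelSpace Λ P) :=
  ⨅ (ε : Λ) (_ : 0 < ε), 𝓟 {c | c ∈ fundChamber P B ∧ modelDist P 0 c < ε}

theorem eventually_germ [Nontrivial Λ] {Q : ModelSpace Λ P → Prop} :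
    (∀ᶠ c in germ P B, Q c) ↔
      ∃ ε : Λ, 0 < ε ∧ ∀ c ∈ fundChamber P B, modelDist P 0 c < ε → Q c := by
  have hb : (germ P B).HasBasis (fun ε : Λ => 0 < ε)
      fun ε => {c | c ∈ fundChamber P B ∧ modelDist P 0 c < ε} := by
    refine hasBasis_biInf_principal (S := {ε : Λ | 0 < ε}) ?_ (exists_zero_lt (α := Λ))
    intro ε hε δ hδ
    exact ⟨min ε δ, lt_min hε hδ, fun c hc => ⟨hc.1, hc.2.trans_le (min_le_left _ _)⟩,
      fun c hc => ⟨hc.1, hc.2.trans_le (min_le_right _ _)⟩⟩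
  rw [hb.eventually_iff]
  simp only [Set.mem_ofPred_eq, and_imp]

theorem eventually_germ_mem [Nontrivial Λ] :
    ∀ᶠ c in germ (Λ := Λ) P B, c ∈ fundChamber P B := by
  obtain ⟨ε, hε⟩ := exists_zero_lt (α := Λ)
  exact eventually_germ.2 ⟨ε, hε, fun c hc _ => hc⟩

theorem eventually_germ_of_forall [Nontrivial Λ] {Q : ModelSpace Λ P → Prop}
    (h : ∀ c ∈ fundChamber P B, Q c) : ∀ᶠ c in germ P B, Q c :=
  eventually_germ_mem.mono h

theorem eventually_germ_dist_lt {ε : Λ} (hε : 0 < ε) :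
    ∀ᶠ c in germ P B, modelDist P 0 c < ε :=
  have : Nontrivial Λ := ⟨⟨ε, 0, hε.ne'⟩⟩
  eventually_germ.2 ⟨ε, hε, fun _ _ h => h⟩

theorem germ_self_of_eventually [Nontrivial Λ] {Q : ModelSpace Λ P → Prop}
    (h : ∀ᶠ c in germ P B, Q c) : Q 0 := by
  obtain ⟨ε, hε, h⟩ := eventually_germ.1 h
  exact h 0 zero_mem_fundChamber (by rwa [modelDist_self])

/-- A property of the germ of the fundamental chamber holds on an initial piece of every ray. -/
theorem exists_forall_tmul_of_eventually [Nontrivial Λ] {Q : ModelSpace Λ P → Prop}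
    (h : ∀ᶠ c in germ P B, Q c) {m : M} (hm : ∀ j ∈ B, 0 ≤ P.coroot' j m) :
    ∃ a₀ : Λ, 0 < a₀ ∧ ∀ a, 0 ≤ a → a ≤ a₀ → Q (m ⊗ₜ a) := by
  obtain ⟨ε, hε, h⟩ := eventually_germ.1 h
  set K : F := ∑ i, |P.coroot' i m| with hK
  have hK0 : 0 ≤ K := Finset.sum_nonneg fun _ _ => abs_nonneg _
  -- The distance from 0 to `m ⊗ a` is `K • a`; the shift by 1 allows for `K = 0` and makes the
  -- bound strict.
  have hK1 : 0 < K + 1 := by linarith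
  refine ⟨(K + 1)⁻¹ • ε, smul_pos (inv_pos.2 hK1) hε, fun a ha haε => h _ (fun j hj => ?_) ?_⟩
  · rw [corootEval_tmul]; exact smul_nonneg (hm j hj) ha
  · have h1 : modelDist P 0 (m ⊗ₜ[F] a) = K • a := by
      simp only [modelDist_zero, corootEval_tmul, abs_smul, abs_of_nonneg ha, hK, Finset.sum_smul]
    rw [h1]
    calc K • a ≤ K • (K + 1)⁻¹ • ε := smul_le_smul_of_nonneg_left haε hK0
      _ = (K * (K + 1)⁻¹) • ε := by rw [smul_smul]
      _ < (1 : F) • ε := by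
        refine smul_lt_smul_of_pos_right ?_ hε
        rw [← div_eq_mul_inv, div_lt_one hK1]
        linarith
      _ = ε := one_smul _ _

theorem exists_forall_rho_of_eventually [Nontrivial Λ] (hB : IsRootBasis P B)
    {Q : ModelSpace Λ P → Prop} (h : ∀ᶠ c in germ P B, Q c) :
    ∃ a₀ : Λ, 0 < a₀ ∧ ∀ a, 0 ≤ a → a ≤ a₀ → Q (rho hB a) :=
  exists_forall_tmul_of_eventually h fun j hj => by
    rw [(hB.exists_coroot_eq fun _ => 1).choose_spec j hj]; exact zero_le_one

/-- An element of the Weyl group is determined by its values on the germ of a chamber. -/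
theorem eq_of_eventually_smul_eq [Nontrivial Λ] (hB : IsRootBasis P B) {w v : sphericalWeyl Λ P}
    (h : ∀ᶠ c in germ (Λ := Λ) P B, w • c = v • c) : w = v := by
  obtain ⟨φ, -, hφ, -⟩ := sphericalWeyl_exists_equiv P w
  obtain ⟨φ', -, hφ', -⟩ := sphericalWeyl_exists_equiv P v
  -- If `m ⊗ a = 0` with `a ≠ 0`, all coroots vanish on `m`, and the root form is anisotropic.
  have h0 : ∀ (m : M) {a : Λ}, a ≠ 0 → m ⊗ₜ[F] a = 0 → m = 0 := by
    intro m a ha hm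
    apply P.eq_zero_of_mem_rootSpan_of_rootForm_self_eq_zero
    · have := RootPairing.IsRootSystem.span_root_eq_top (P := P)
      change m ∈ Submodule.span F (Set.range P.root)
      rw [this]; trivial
    · rw [P.rootForm_apply_apply]
      refine Finset.sum_eq_zero fun i _ => ?_
      have h1 := corootEval_tmul P i m a
      rw [hm, map_zero, eq_comm, smul_eq_zero_iff_left ha] at h1
      rw [h1, zero_mul]
  have h1 : ∀ m : M, (∀ j ∈ B, 0 ≤ P.coroot' j m) → φ m = φ' m := by
    intro m hm
    obtain ⟨a, ha, h⟩ := exists_forall_tmul_of_eventually h hm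
    have := h a ha.le le_rfl
    rw [hφ, hφ', ← sub_eq_zero, ← TensorProduct.sub_tmul] at this
    exact sub_eq_zero.1 (h0 _ ha.ne' this)
  refine sphericalWeyl_ext P fun m a => ?_
  rw [hφ, hφ']
  congr 1
  -- Any `m` is the difference of the dominant vectors `m + r` and `r`, on which the two maps are
  -- already known to agree.
  obtain ⟨r, hr⟩ := hB.exists_coroot_eq fun j => |P.coroot' j m|
  have hr' := h1 r fun j hj => by rw [hr j hj]; exact abs_nonneg _
  have hm := h1 (m + r) fun j hj => by
    rw [map_add, hr j hj]; linarith [neg_abs_le (P.coroot' j m)]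
  rwa [map_add, map_add, hr', add_left_inj] at hm

/-- Near `a`, a chamber germ based at `a` lies in a single chamber based at `0`. -/
theorem exists_eventually_inv_smul_mem [Nontrivial Λ] (hB : IsRootBasis P B)
    (a : ModelSpace Λ P) (k : sphericalWeyl Λ P) :
    ∃ v : sphericalWeyl Λ P, ∀ᶠ c in germ P B, v⁻¹ • (a + k • c) ∈ fundChamber P B := by
  -- Coroots that are nonzero at `a` keep their sign within distance `δ`. Inserting `ε` covers the
  -- case in which all coroots vanish at `a`.
  obtain ⟨δ, hδ, hδa⟩ : ∃ δ : Λ, 0 < δ ∧ ∀ i, corootEval Λ P i a ≠ 0 →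
      δ ≤ |corootEval Λ P i a| := by
    obtain ⟨ε, hε⟩ := exists_zero_lt (α := Λ)
    classical
    set s : Finset Λ := insert ε ((Finset.univ.filter fun i => corootEval Λ P i a ≠ 0).image
      fun i => |corootEval Λ P i a|) with hs
    have hne : s.Nonempty := Finset.insert_nonempty _ _
    refine ⟨s.min' hne, ?_, fun i hi => Finset.min'_le _ _ (by
      rw [hs]
      exact Finset.mem_insert_of_mem (Finset.mem_image.2 ⟨i, by simpa using hi, rfl⟩))⟩
    rw [Finset.lt_min'_iff]
    intro x hx
    rw [hs, Finset.mem_insert, Finset.mem_image] at hx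
    obtain rfl | ⟨i, hi, rfl⟩ := hx
    · exact hε
    · exact abs_pos.2 (by simpa using hi)
  obtain ⟨a₀, ha₀, hr⟩ := exists_forall_rho_of_eventually hB
    (eventually_germ_dist_lt (P := P) (B := B) hδ)
  -- One regular point of the germ selects `v`. Coroots vanishing at `a` have the same weak sign on
  -- the whole germ as at this point.
  obtain ⟨v, hv⟩ := exists_inv_smul_mem_fundChamber hB (a + k • rho hB a₀)
  refine ⟨v, ?_⟩
  filter_upwards [eventually_germ_dist_lt (P := P) (B := B) hδ, eventually_germ_mem]
    with c hc hcC j hj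
  obtain ⟨σ, hσ⟩ := corootEval_smul_perm P v⁻¹
  obtain ⟨τ, hτ⟩ := corootEval_smul_perm P k
  have h1 := hv j hj
  rw [hσ, map_add, hτ] at h1 ⊢
  have h2 := (abs_corootEval_le_modelDist (τ (σ j)) (rho hB a₀)).trans_lt (hr a₀ ha₀.le le_rfl)
  have h3 := (abs_corootEval_le_modelDist (τ (σ j)) c).trans_lt hc
  by_cases h0 : corootEval Λ P (σ j) a = 0
  · rw [h0, zero_add] at h1 ⊢
    exact (corootEval_nonneg_of_pos hB (rho_regular hB ha₀) h1).2 c hcC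
  · have h4 := hδa _ h0
    rw [abs_lt] at h2 h3
    rcases abs_cases (corootEval Λ P (σ j) a) with h | h
    · rw [h.1] at h4
      exact (neg_lt_iff_pos_add.1 (neg_lt.1 ((neg_le_neg h4).trans_lt h3.1))).le
    · rw [h.1] at h4
      exact absurd h1 (not_le.2 (lt_neg_iff_add_neg'.1 (h2.2.trans_le h4)))

/-! ### Convex sets -/

/-- Both `c'` and `c - c'` lie in the chamber, where each coroot has one sign. Absolute values then
add up coroot by coroot, which places the point on the segment. -/
theorem IsModelConvex.mem_of_dominated (hB : IsRootBasis P B) {Y : Set (ModelSpace Λ P)}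
    (hY : IsModelConvex P Y) {p c c' : ModelSpace Λ P} (w : sphericalWeyl Λ P) (hp : p ∈ Y)
    (hc : p + w • c ∈ Y) (hc' : c' ∈ fundChamber P B) (hcc' : c - c' ∈ fundChamber P B) :
    p + w • c' ∈ Y := by
  refine hY _ hp _ hc ?_
  have e : p + w • c = (p + w • c') + w • (c - c') := by rw [smul_sub]; abel
  change _ = _ + _
  rw [e, modelDist_self_add, modelDist_self_add, ← e, modelDist_self_add, modelDist_zero_smul,
    modelDist_zero_smul, modelDist_zero_smul]
  simp only [modelDist_zero, ← Finset.sum_add_distrib]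
  refine Finset.sum_congr rfl fun i _ => ?_
  have e' : corootEval Λ P i c = corootEval Λ P i c' + corootEval Λ P i (c - c') := by
    rw [← map_add]; congr 1; abel
  rw [e']
  obtain ⟨h, -⟩ | ⟨h, -⟩ := corootEval_sign (Λ := Λ) hB i
  · exact abs_add_eq_add_abs_iff _ _ |>.2 (.inl ⟨h _ hc', h _ hcc'⟩)
  · exact abs_add_eq_add_abs_iff _ _ |>.2 (.inr ⟨h _ hc', h _ hcc'⟩)

/-- A convex set that contains the base point and a regular point of a chamber contains its
germ. -/
theorem IsModelConvex.eventually_mem [Nontrivial Λ] (hB : IsRootBasis P B)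
    {Y : Set (ModelSpace Λ P)} (hY : IsModelConvex P Y) {p c : ModelSpace Λ P}
    (w : sphericalWeyl Λ P) (hp : p ∈ Y) (hc : p + w • c ∈ Y)
    (hreg : ∀ j ∈ B, 0 < corootEval Λ P j c) : ∀ᶠ c' in germ P B, p + w • c' ∈ Y := by
  have h : ∀ᶠ c' in germ P B, ∀ j ∈ B, corootEval Λ P j c' ≤ corootEval Λ P j c := by
    rw [eventually_all_finset]
    intro j hj
    filter_upwards [eventually_germ_dist_lt (P := P) (B := B) (hreg j hj)] with c' hc'
    exact (le_abs_self _).trans ((abs_corootEval_le_modelDist j c').trans hc'.le)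
  filter_upwards [h, eventually_germ_mem] with c' h1 h2
  exact hY.mem_of_dominated hB w hp hc h2 fun j hj => by
    rw [map_sub]; exact sub_nonneg.2 (h1 j hj)

/-- A convex set that contains two opposite chamber germs contains a neighbourhood of their base
point. -/
theorem IsModelConvex.eventually_mem_of_opp [Nontrivial Λ] (hB : IsRootBasis P B)
    {Y : Set (ModelSpace Λ P)} (hY : IsModelConvex P Y) {p : ModelSpace Λ P}
    {w v : sphericalWeyl Λ P} (hwv : Opp B w v) (hw : ∀ᶠ c in germ P B, p + w • c ∈ Y)
    (hv : ∀ᶠ c in germ P B, p + v • c ∈ Y) (k : sphericalWeyl Λ P) :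
    ∀ᶠ c in germ P B, p + k • c ∈ Y := by
  obtain ⟨ε, hε, hv⟩ := eventually_germ.1 hv
  obtain ⟨a, ha, h⟩ := exists_forall_rho_of_eventually hB
    (hw.and (eventually_germ_dist_lt (P := P) (B := B) hε))
  obtain ⟨h1, h2⟩ := h a ha.le le_rfl
  obtain ⟨c, hc, hcw⟩ := hwv.exists_smul_eq (rho_mem_fundChamber hB ha.le)
  have h3 : p - w • rho hB a ∈ Y := by
    rw [sub_eq_add_neg, ← hcw]
    refine hv c hc ?_
    rwa [← modelDist_zero_smul v, hcw, modelDist_zero_neg, modelDist_zero_smul]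
  filter_upwards [eventually_germ_dist_lt (P := P) (B := B) ha] with c' hc'
  -- With the base moved to `p - w ρ`, the points near `p` fill an order interval from `p - w ρ` to
  -- `p + w ρ`, regardless of the direction `k`.
  have e1 : p + w • rho hB a = (p - w • rho hB a) + w • (rho hB a + rho hB a) := by
    rw [smul_add]; abel
  have e2 : p + k • c' = (p - w • rho hB a) + w • (rho hB a + w⁻¹ • k • c') := by
    rw [smul_add, smul_inv_smul]; abel
  rw [e1] at h1
  rw [e2]
  have h4 : ∀ j ∈ B, |corootEval Λ P j (w⁻¹ • k • c')| ≤ a := fun j _ => by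
    refine (abs_corootEval_le_modelDist j _).trans ?_
    rw [modelDist_zero_smul, modelDist_zero_smul]
    exact hc'.le
  refine hY.mem_of_dominated hB w h3 h1 (fun j hj => ?_) fun j hj => ?_
  · rw [map_add, corootEval_rho hB a hj]
    exact neg_le_iff_add_nonneg'.1 (abs_le.1 (h4 j hj)).1
  · rw [add_sub_add_left_eq_sub, map_sub, corootEval_rho hB a hj]
    exact sub_nonneg.2 (abs_le.1 (h4 j hj)).2

/-- A convex set that contains `p` and arbitrarily far points of a regular ray from `p` contains
the chamber based at `p`. -/
theorem IsModelConvex.chamber_mem_of_ray [Nontrivial Λ] (hB : IsRootBasis P B)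
    {Y : Set (ModelSpace Λ P)} (hY : IsModelConvex P Y) {p : ModelSpace Λ P}
    (w : sphericalWeyl Λ P) (hp : p ∈ Y) {x : ModelSpace Λ P}
    (h : ∀ a₀ : Λ, ∃ a, a₀ ≤ a ∧ p + w • (x + rho hB a) ∈ Y) {c : ModelSpace Λ P}
    (hc : c ∈ fundChamber P B) : p + w • c ∈ Y := by
  obtain ⟨a₀, -, ha₀⟩ := exists_forall_add_rho_regular hB (x - c)
  obtain ⟨a, ha, h⟩ := h a₀
  refine hY.mem_of_dominated hB w hp h hc fun j hj => ?_
  rw [add_sub_right_comm]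
  exact (ha₀ a ha j hj).le

/-- A convex set that contains `p` and a chamber contains the parallel chamber based at `p`. -/
theorem IsModelConvex.chamber_mem_of_parallel [Nontrivial Λ] (hB : IsRootBasis P B)
    {Y : Set (ModelSpace Λ P)} (hY : IsModelConvex P Y) {p q : ModelSpace Λ P}
    (w : sphericalWeyl Λ P) (hp : p ∈ Y) (hq : ∀ c ∈ fundChamber P B, q + w • c ∈ Y)
    {c : ModelSpace Λ P} (hc : c ∈ fundChamber P B) : p + w • c ∈ Y := by
  refine hY.chamber_mem_of_ray hB w hp (x := w⁻¹ • (q - p)) (fun a₀ => ?_) hc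
  refine ⟨|a₀|, le_abs_self _, ?_⟩
  have := hq _ (rho_mem_fundChamber hB (abs_nonneg a₀))
  rwa [smul_add, smul_inv_smul, ← add_assoc, add_sub_cancel]

end Germs

section Charts

open Filter

variable {F : Subfield ℝ} {ι M N : Type*} [Fintype ι] [AddCommGroup M] [Module F M]
  [AddCommGroup N] [Module F N] {Λ : Type*} [AddCommGroup Λ] [LinearOrder Λ]
  [IsOrderedAddMonoid Λ] [Module F Λ] [IsStrictOrderedModule F Λ]
  {P : RootPairing ι F M N} [P.IsRootSystem] {B : Finset ι}
  {X : Type*} {T : AddSubgroup (ModelSpace Λ P)} {A : Set (ModelSpace Λ P → X)}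
  {f g h : ModelSpace Λ P → X} {p q : ModelSpace Λ P} {w v : sphericalWeyl Λ P}

/-! ### Transition maps -/

/-- The charts `f` and `g` coincide where their apartments meet. -/
def Agree (f g : ModelSpace Λ P → X) : Prop :=
  ∀ z, f z ∈ Set.range g → f z = g z

theorem Agree.isModelConvex (h2 : A2 P T A) (hf : f ∈ A) (hg : g ∈ A) (h : Agree f g)
    (hp : f p = g p) : IsModelConvex P {z | f z = g z} := by
  have : {z | f z = g z} = f ⁻¹' Set.range g :=
    Set.ext fun z => ⟨fun hz => ⟨z, hz.symm⟩, fun hz => h z hz⟩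
  rw [this]
  exact (h2 f hf g hg ⟨f p, ⟨p, rfl⟩, ⟨p, hp.symm⟩⟩).2.1

/-- This is (A2) with origins at `p` and `q`: the translation part is absorbed and only an element
of the spherical Weyl group remains. -/
theorem exists_transition (hA : IsModeled P A) (h2 : A2 P T A) (hf : f ∈ A) (hg : g ∈ A)
    (hp : f p = g q) :
    ∃ m : sphericalWeyl Λ P, ∀ z, f (p + z) ∈ Set.range g → f (p + z) = g (q + m • z) := by
  obtain ⟨-, -, u, hu, hfu⟩ := h2 f hf g hg ⟨f p, ⟨p, rfl⟩, ⟨q, hp.symm⟩⟩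
  obtain ⟨m, hm⟩ := exists_of_mem_affineWeyl hu
  have hup : u p = q := hA.1 g hg (by
    rw [← hp]; exact (hfu (x := p) ⟨q, hp.symm⟩).symm)
  exact ⟨m, fun z hz => by rw [hfu hz, Function.comp_apply, hm, hup]⟩

/-- If the apartments of `f` and `g` meet, then the apartment of `g` has a chart that coincides
with `f` on the intersection. -/
theorem exists_agree (hA : IsModeled P A) (h1 : A1 P T A) (h2 : A2 P T A) (hf : f ∈ A)
    (hg : g ∈ A) (hp : f p = g q) :
    ∃ m : sphericalWeyl Λ P, ∃ g' ∈ A, Set.range g' = Set.range g ∧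
      (∀ z, g' (p + z) = g (q + m • z)) ∧ Agree f g' := by
  obtain ⟨-, -, u, hu, hfu⟩ := h2 f hf g hg ⟨f p, ⟨p, rfl⟩, ⟨q, hp.symm⟩⟩
  obtain ⟨m, hm⟩ := exists_of_mem_affineWeyl hu
  have hup : u p = q := hA.1 g hg (by
    rw [← hp]; exact (hfu (x := p) ⟨q, hp.symm⟩).symm)
  have hr : Set.range (g ∘ u) = Set.range g := (surjective_of_mem_affineWeyl hu).range_comp g
  refine ⟨m, g ∘ u, h1 g hg u hu, hr, fun z => ?_, fun z hz => ?_⟩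
  · rw [Function.comp_apply, hm, hup]
  · rw [hr] at hz
    exact hfu hz

theorem exists_agree_of_mem (hA : IsModeled P A) (h1 : A1 P T A) (h2 : A2 P T A) (hf : f ∈ A)
    (hg : g ∈ A) (hp : f p ∈ Set.range g) :
    ∃ g' ∈ A, Set.range g' = Set.range g ∧ Agree f g' := by
  obtain ⟨q, hq⟩ := hp
  obtain ⟨m, g', hg', hr, -, h⟩ := exists_agree hA h1 h2 hf hg hq.symm
  exact ⟨g', hg', hr, h⟩

/-- Charts that coincide on a chamber germ coincide where their apartments meet. -/
theorem agree_of_eventually [Nontrivial Λ] (hB : IsRootBasis P B) (hA : IsModeled P A)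
    (h2 : A2 P T A) (hf : f ∈ A) (hg : g ∈ A)
    (h : ∀ᶠ c in germ P B, f (p + w • c) = g (p + w • c)) : Agree f g := by
  have hp : f p = g p := by simpa using germ_self_of_eventually h
  obtain ⟨m, hm⟩ := exists_transition hA h2 hf hg hp
  have hmw : m * w = w := eq_of_eventually_smul_eq hB <| by
    filter_upwards [h] with c hc
    have := hm (w • c) ⟨_, hc.symm⟩
    rw [hc] at this
    rw [mul_smul]
    exact (add_left_cancel (hA.1 g hg this)).symm
  intro z hz
  have := hm (z - p) (by rwa [add_sub_cancel])
  rwa [mul_eq_right.1 hmw, one_smul, add_sub_cancel] at this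

theorem agree_of_forall [Nontrivial Λ] (hB : IsRootBasis P B) (hA : IsModeled P A)
    (h2 : A2 P T A) (hf : f ∈ A) (hg : g ∈ A)
    (h : ∀ c ∈ fundChamber P B, f (p + w • c) = g (p + w • c)) : Agree f g :=
  agree_of_eventually hB hA h2 hf hg (eventually_germ_of_forall h)

/-! ### Chambers and germs in charts -/

/-- Transition maps are isometries, so balls can be read in any chart through the centre. This turns
germ conditions in `X` into statements along the filter `germ`. -/
theorem mem_ball_iff (hA : IsModeled P A) (h2 : A2 P T A) (hf : f ∈ A) {ε : Λ} :
    f q ∈ ball P A (f p) ε ↔ modelDist P p q < ε := by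
  refine ⟨?_, fun h => ⟨f, hf, p, q, rfl, rfl, h⟩⟩
  rintro ⟨g, hg, p', q', hp, hq, h⟩
  obtain ⟨m, hm⟩ := exists_transition hA h2 hf hg hp.symm
  have := hm (q - p) (by rw [add_sub_cancel, ← hq]; exact ⟨q', rfl⟩)
  rw [add_sub_cancel, ← hq] at this
  rw [hA.1 g hg this, modelDist_self_add, modelDist_zero_smul, ← modelDist_self_add p,
    add_sub_cancel] at h
  exact h

theorem mem_image_chamber {y : X} :
    y ∈ f '' chamber P B p w ↔ ∃ c ∈ fundChamber P B, f (p + w • c) = y := by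
  constructor
  · rintro ⟨_, ⟨c, hc, rfl⟩, rfl⟩
    exact ⟨c, hc, rfl⟩
  · rintro ⟨c, hc, rfl⟩
    exact ⟨_, ⟨c, hc, rfl⟩, rfl⟩

theorem image_chamber_subset_iff {Y : Set X} :
    f '' chamber P B p w ⊆ Y ↔ ∀ c ∈ fundChamber P B, f (p + w • c) ∈ Y := by
  constructor
  · exact fun h c hc => h (mem_image_chamber.2 ⟨c, hc, rfl⟩)
  · intro h y hy
    obtain ⟨c, hc, rfl⟩ := mem_image_chamber.1 hy
    exact h c hc

theorem oppChamber_eq (hwv : Opp B w v) : oppChamber P B p w = chamber P B p v := by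
  ext x
  constructor
  · rintro ⟨c, hc, rfl⟩
    obtain ⟨c', hc', h⟩ := hwv.exists_smul_eq hc
    exact ⟨c', hc', by rw [sub_eq_add_neg]; exact congrArg (p + ·) h.symm⟩
  · rintro ⟨c, hc, rfl⟩
    obtain ⟨c', hc', h⟩ := hwv.symm.exists_smul_eq hc
    refine ⟨c', hc', ?_⟩
    rw [sub_eq_add_neg]
    exact congrArg (p + ·) (neg_eq_iff_eq_neg.2 h).symm

theorem isChamberAt_image (hf : f ∈ A) : IsChamberAt P B A (f p) (f '' chamber P B p w) :=
  ⟨f, hf, p, rfl, w, w.2, rfl⟩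

theorem IsChamberAt.exists_eq {x : X} {S : Set X} (h : IsChamberAt P B A x S) :
    ∃ f ∈ A, ∃ p, ∃ w : sphericalWeyl Λ P, f p = x ∧ S = f '' chamber P B p w := by
  obtain ⟨f, hf, p, hp, w, hw, hS⟩ := h
  exact ⟨f, hf, p, ⟨w, hw⟩, hp, hS⟩

theorem germIn_iff [Nontrivial Λ] (hA : IsModeled P A) (h2 : A2 P T A) (hf : f ∈ A) {Y : Set X} :
    GermIn P A (f p) (f '' chamber P B p w) Y ↔ ∀ᶠ c in germ P B, f (p + w • c) ∈ Y := by
  rw [eventually_germ]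
  constructor
  · rintro ⟨ε, hε, h⟩
    refine ⟨ε, hε, fun c hc hd => h ⟨mem_image_chamber.2 ⟨c, hc, rfl⟩, ?_⟩⟩
    rwa [mem_ball_iff hA h2 hf, modelDist_self_add, modelDist_zero_smul]
  · rintro ⟨ε, hε, h⟩
    refine ⟨ε, hε, ?_⟩
    rintro y ⟨hy, hyb⟩
    obtain ⟨c, hc, rfl⟩ := mem_image_chamber.1 hy
    rw [mem_ball_iff hA h2 hf, modelDist_self_add, modelDist_zero_smul] at hyb
    exact h c hc hyb

theorem sameGerm_of_eventually [Nontrivial Λ] (hA : IsModeled P A) (h2 : A2 P T A) (hf : f ∈ A)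
    (hg : g ∈ A) (h : ∀ᶠ c in germ P B, f (p + w • c) = g (q + v • c)) :
    SameGerm P A (f p) (f '' chamber P B p w) (g '' chamber P B q v) := by
  have hp : f p = g q := by simpa using germ_self_of_eventually h
  obtain ⟨ε, hε, h⟩ := eventually_germ.1 h
  refine ⟨ε, hε, ?_, ?_⟩
  · rintro y ⟨hy, hyb⟩
    obtain ⟨c, hc, rfl⟩ := mem_image_chamber.1 hy
    rw [mem_ball_iff hA h2 hf, modelDist_self_add, modelDist_zero_smul] at hyb
    exact mem_image_chamber.2 ⟨c, hc, (h c hc hyb).symm⟩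
  · rintro y ⟨hy, hyb⟩
    obtain ⟨c, hc, rfl⟩ := mem_image_chamber.1 hy
    rw [hp, mem_ball_iff hA h2 hg, modelDist_self_add, modelDist_zero_smul] at hyb
    exact mem_image_chamber.2 ⟨c, hc, h c hc hyb⟩

/-! ### Opposite chambers -/

/-- Chambers with opposite germs lie in a common apartment. -/
theorem CO.exists_chart [Nontrivial Λ] (hCO : CO P B A) (hB : IsRootBasis P B)
    (hA : IsModeled P A) (h1 : A1 P T A) (h2 : A2 P T A) (hf : f ∈ A) (hg : g ∈ A) (hh : h ∈ A)
    {w' v' : sphericalWeyl Λ P} (hv : Opp B v v')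
    (hfh : ∀ᶠ c in germ P B, f (p + w • c) = h (p + v • c))
    (hgh : ∀ᶠ c in germ P B, g (p + w' • c) = h (p + v' • c)) :
    ∃ e ∈ A, ∃ k, (∀ c ∈ fundChamber P B, f (p + w • c) = e (p + w • c)) ∧
      (∀ c ∈ fundChamber P B, g (p + w' • c) = e (p + k • c)) ∧ Opp B w k := by
  have hfp : f p = h p := by simpa using germ_self_of_eventually hfh
  have hgp : g p = h p := by simpa using germ_self_of_eventually hgh
  have hopp : OppositeAt P B A (f p) (f '' chamber P B p w) (g '' chamber P B p w') := by
    refine ⟨h, hh, p, hfp.symm, v, v.2, sameGerm_of_eventually hA h2 hf hh hfh, ?_⟩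
    rw [oppChamber_eq hv, hfp, ← hgp]
    exact sameGerm_of_eventually hA h2 hg hh hgh
  obtain ⟨_, ⟨⟨e₀, he₀, rfl⟩, hS, hS'⟩, -⟩ := hCO _ _ _ (isChamberAt_image hf)
    (by rw [hfp, ← hgp]; exact isChamberAt_image hg) hopp
  rw [image_chamber_subset_iff] at hS hS'
  obtain ⟨e, he, her, hfe⟩ := exists_agree_of_mem (p := p) hA h1 h2 hf he₀
    (by simpa using hS 0 zero_mem_fundChamber)
  rw [← her] at hS hS'
  have hfe' : ∀ c ∈ fundChamber P B, f (p + w • c) = e (p + w • c) := fun c hc => hfe _ (hS c hc)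
  have hep : f p = e p := by simpa using hfe' 0 zero_mem_fundChamber
  obtain ⟨k, hk⟩ := exists_transition hA h2 hg he (p := p) (q := p) (by rw [hgp, ← hfp, hep])
  -- The linear part `m` from `e` to `h` carries both directions in `e` to the opposite pair `v`,
  -- `v'`; opposition can be pulled back along it.
  obtain ⟨m, hm⟩ := exists_transition hA h2 he hh (p := p) (q := p) (by rw [← hfp, hep])
  have hmw : m * w = v := eq_of_eventually_smul_eq hB <| by
    filter_upwards [hfh, eventually_germ_mem] with c hc hcC
    rw [hfe' c hcC] at hc
    have := hm (w • c) ⟨_, hc.symm⟩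
    rw [hc] at this
    rw [mul_smul]
    exact (add_left_cancel (hA.1 h hh this)).symm
  have hmk : m * (k * w') = v' := eq_of_eventually_smul_eq hB <| by
    filter_upwards [hgh, eventually_germ_mem] with c hc hcC
    rw [hk _ (hS' c hcC)] at hc
    have := hm (k • w' • c) ⟨_, hc.symm⟩
    rw [hc] at this
    rw [mul_smul, mul_smul]
    exact (add_left_cancel (hA.1 h hh this)).symm
  refine ⟨e, he, k * w', hfe', fun c hc => ?_, ?_⟩
  · rw [mul_smul]; exact hk _ (hS' c hc)
  · rw [← hmw, ← hmk] at hv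
    exact hv.of_mul_left

/-- An apartment is determined by two opposite chambers. -/
theorem CO.range_eq [Nontrivial Λ] (hCO : CO P B A) (hA : IsModeled P A) (h2 : A2 P T A)
    (hf : f ∈ A) (hg : g ∈ A) (hwv : Opp B w v)
    (hw : ∀ c ∈ fundChamber P B, f (p + w • c) = g (p + w • c))
    (hv : ∀ c ∈ fundChamber P B, f (p + v • c) = g (p + v • c)) : Set.range f = Set.range g := by
  have hopp : OppositeAt P B A (f p) (f '' chamber P B p w) (f '' chamber P B p v) := by
    refine ⟨f, hf, p, rfl, w, w.2, sameGerm_of_eventually hA h2 hf hf (.of_forall fun _ => rfl), ?_⟩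
    rw [oppChamber_eq hwv]
    exact sameGerm_of_eventually hA h2 hf hf (.of_forall fun _ => rfl)
  refine (hCO _ _ _ (isChamberAt_image hf) (isChamberAt_image hf) hopp).unique
    ⟨⟨f, hf, rfl⟩, Set.image_subset_range _ _, Set.image_subset_range _ _⟩ ⟨⟨g, hg, rfl⟩, ?_, ?_⟩
  · exact image_chamber_subset_iff.2 fun c hc => ⟨_, (hw c hc).symm⟩
  · exact image_chamber_subset_iff.2 fun c hc => ⟨_, (hv c hc).symm⟩

end Charts

/-! ### The equivalence of the two systems of axioms. -/

section Main

open Filter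

variable {F : Subfield ℝ} {ι M N : Type*} [Fintype ι] [AddCommGroup M] [Module F M]
  [AddCommGroup N] [Module F N] {Λ : Type*} [AddCommGroup Λ] [LinearOrder Λ]
  [IsOrderedAddMonoid Λ] [Module F Λ] [IsStrictOrderedModule F Λ]
  {P : RootPairing ι F M N} [P.IsRootSystem] {B : Finset ι}
  {X : Type*} {T : AddSubgroup (ModelSpace Λ P)} {A : Set (ModelSpace Λ P → X)}
  {f g : ModelSpace Λ P → X} {p q : ModelSpace Λ P} {w v : sphericalWeyl Λ P}

/-- A chamber and a chamber germ with the same base point lie in a common apartment. -/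
theorem exists_chart_chamber_germ [Nontrivial Λ] (hB : IsRootBasis P B) (hA : IsModeled P A)
    (h1 : A1 P T A) (h2 : A2 P T A) (hGG : GG P B A) (hCO : CO P B A) (hf : f ∈ A) (hg : g ∈ A)
    (hp : f p = g p) (w w' : sphericalWeyl Λ P) :
    ∃ h ∈ A, ∃ k : sphericalWeyl Λ P, (∀ c ∈ fundChamber P B, f (p + w • c) = h (p + w • c)) ∧
      ∀ᶠ c in germ P B, g (p + w' • c) = h (p + k • c) := by
  obtain ⟨_, ⟨h₀, hh₀, rfl⟩, hfY, hgY⟩ := hGG (f p) (f '' chamber P B p w) (g '' chamber P B p w')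
    (isChamberAt_image hf) (by rw [hp]; exact isChamberAt_image hg)
  rw [germIn_iff hA h2 hf] at hfY
  rw [hp, germIn_iff hA h2 hg] at hgY
  obtain ⟨h, hh, hr, hfh⟩ := exists_agree_of_mem (p := p) hA h1 h2 hf hh₀
    (by simpa using germ_self_of_eventually hfY)
  rw [← hr] at hfY hgY
  have hfh' : ∀ᶠ c in germ P B, f (p + w • c) = h (p + w • c) := hfY.mono fun c hc => hfh _ hc
  have hhp : f p = h p := by simpa using germ_self_of_eventually hfh'
  obtain ⟨m, hm⟩ := exists_transition hA h2 hg hh (hp.symm.trans hhp)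
  -- In the apartment of `h`, take the chamber opposite to the germ of `f`. By (CO) it spans an
  -- apartment `e` with the whole chamber of `f`. Then `h` and `e` share two opposite germs at `p`,
  -- hence all germs of `h` at `p`, including that of `g`.
  obtain ⟨v, hv⟩ := exists_opp (Λ := Λ) hB w
  obtain ⟨e, he, k, hfe, hhe, -⟩ := hCO.exists_chart hB hA h1 h2 hf hh hh hv hfh'
    (.of_forall fun _ => rfl)
  have hagree : Agree h e := agree_of_eventually (p := p) (w := w) hB hA h2 hh he <| by
    filter_upwards [hfh', eventually_germ_mem] with c hc hcC
    rw [← hc, hfe c hcC]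
  have hconv := hagree.isModelConvex h2 hh he (p := p) (by
    rw [← hhp]; simpa using hfe 0 zero_mem_fundChamber)
  refine ⟨e, he, m * w', hfe, ?_⟩
  have hball := hconv.eventually_mem_of_opp hB (p := p) hv
    (by filter_upwards [hfh', eventually_germ_mem] with c hc hcC
        rw [← hc, hfe c hcC])
    (eventually_germ_of_forall fun c hc => hagree _ ⟨_, (hhe c hc).symm⟩) (m * w')
  filter_upwards [hball, hgY] with c hc hgc
  rw [hm _ hgc, ← mul_smul]
  exact hc

/-- Start from an apartment through both base points and enlarge in two rounds: absorb the germ at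
`y` while keeping a chamber that reaches `x`, then absorb the germ at `x` while keeping a chamber
that contains the germ at `y`. -/
theorem A3'_of_A3 (hB : IsRootBasis P B) (hA : IsModeled P A)
    (h1 : A1 P T A) (h2 : A2 P T A) (h3 : A3 P A) (hGG : GG P B A) (hCO : CO P B A) :
    A3' P B A := by
  intro x y S S' hS hS'
  -- A germ condition supplies a positive radius, so `Λ` is nontrivial.
  obtain ⟨-, -, ⟨ε, hε, -⟩, -⟩ := hGG x S S hS hS
  have : Nontrivial Λ := ⟨⟨ε, 0, hε.ne'⟩⟩
  obtain ⟨f, hf, p, w, rfl, rfl⟩ := hS.exists_eq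
  obtain ⟨g, hg, q, w', rfl, rfl⟩ := hS'.exists_eq
  obtain ⟨_, ⟨h₀, hh₀, rfl⟩, hx, hy⟩ := h3 (f p) (g q)
  obtain ⟨h, hh, hr, hgh⟩ := exists_agree_of_mem hA h1 h2 hg hh₀ hy
  rw [← hr] at hx hy
  obtain ⟨p₁, hp₁⟩ := hx
  -- The chamber in direction `v` at `q` contains `p₁`, so keeping it keeps the first base point.
  obtain ⟨v, hv⟩ := exists_inv_smul_mem_fundChamber (Λ := Λ) hB (p₁ - q)
  obtain ⟨h', hh', k, hhh', hgh'⟩ := exists_chart_chamber_germ hB hA h1 h2 hGG hCO hh hg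
    (hgh q hy).symm v w'
  have hp₁' : h' p₁ = f p := by
    have := hhh' _ hv
    rw [smul_inv_smul, add_sub_cancel] at this
    rw [← this, hp₁]
  -- The chamber in direction `v'` at `p₁` contains the whole germ at `q`, which therefore survives
  -- the second round.
  obtain ⟨v', hv'⟩ := exists_eventually_inv_smul_mem hB (q - p₁) k
  obtain ⟨m, f', hf', -, hff', hagree⟩ := exists_agree hA h1 h2 hh' hf hp₁'
  have hfp₁ : f' p₁ = f p := by simpa using hff' 0
  obtain ⟨e, he, k', hhe, hfe⟩ := exists_chart_chamber_germ hB hA h1 h2 hGG hCO hh' hf'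
    (hp₁'.trans hfp₁.symm) v' (m⁻¹ * w)
  refine ⟨_, ⟨e, he, rfl⟩, ?_, ?_⟩
  · rw [germIn_iff hA h2 hf]
    filter_upwards [hfe] with c hc
    rw [hff', mul_smul, smul_inv_smul] at hc
    exact ⟨_, hc.symm⟩
  · rw [germIn_iff hA h2 hg]
    filter_upwards [hgh', hv'] with c hc hcC
    have := hhe _ hcC
    rw [smul_inv_smul, ← add_assoc, add_sub_cancel] at this
    exact ⟨_, by rw [hc, this]⟩

theorem A3_of_A3' (hA : IsModeled P A) (h : A3' P B A) : A3 P A := by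
  intro x y
  obtain ⟨f, hf, p, rfl⟩ := hA.2 x
  obtain ⟨g, hg, q, rfl⟩ := hA.2 y
  obtain ⟨Y, hY, ⟨ε, hε, hfY⟩, ⟨δ, hδ, hgY⟩⟩ := h _ _ (f '' chamber P B p (1 : sphericalWeyl Λ P))
    (g '' chamber P B q (1 : sphericalWeyl Λ P)) (isChamberAt_image hf) (isChamberAt_image hg)
  refine ⟨Y, hY, hfY ⟨?_, ?_⟩, hgY ⟨?_, ?_⟩⟩
  · exact mem_image_chamber.2 ⟨0, zero_mem_fundChamber, by simp⟩
  · exact ⟨f, hf, p, p, rfl, rfl, by rwa [modelDist_self]⟩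
  · exact mem_image_chamber.2 ⟨0, zero_mem_fundChamber, by simp⟩
  · exact ⟨g, hg, q, q, rfl, rfl, by rwa [modelDist_self]⟩

/-! ### Opposite chambers and (A4). -/

/-- Every apartment through the base point `x` of a chamber `S` contains a chamber based at `x`
that is opposite to `S`. -/
theorem exists_opp_chamber [Nontrivial Λ] (hB : IsRootBasis P B) (hA : IsModeled P A)
    (h1 : A1 P T A) (h2 : A2 P T A) (hGG : GG P B A) (hCO : CO P B A) (hf : f ∈ A) (hg : g ∈ A)
    (hp : f p = g p) (w' : sphericalWeyl Λ P) :
    ∃ u k : sphericalWeyl Λ P, ∃ h ∈ A, Opp B u k ∧ (∀ c ∈ fundChamber P B, f (p + u • c) = h (p + u • c)) ∧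
      ∀ c ∈ fundChamber P B, g (p + w' • c) = h (p + k • c) := by
  choose H hH K hgH hfH using fun u : sphericalWeyl Λ P =>
    exists_chart_chamber_germ hB hA h1 h2 hGG hCO hg hf hp.symm w' u
  obtain ⟨ψ, hψ⟩ := exists_height (Λ := Λ) hB
  obtain ⟨a, ha⟩ := exists_zero_lt (α := Λ)
  -- Minimal height selects the germ of the apartment of `f` that is farthest from the chamber of
  -- `g`. If it is not opposite, crossing a panel lowers the height further.
  obtain ⟨u, hu⟩ := Finite.exists_min fun u => ψ ((K u)⁻¹ • w' • rho hB a)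
  have hHp : ∀ u, g p = H u p := fun u => by simpa using hgH u 0 zero_mem_fundChamber
  suffices hneg : ∀ j ∈ B, corootEval Λ P j ((K u)⁻¹ • w' • rho hB a) ≤ 0 by
    have hopp : Opp B w' (K u) := opp_of_regular hB (rho_regular hB ha) fun j hj => by
      rw [map_neg]; exact neg_nonneg.2 (hneg j hj)
    obtain ⟨e, he, k, hfe, hge, hk⟩ := hCO.exists_chart hB hA h1 h2 hf hg (hH u) hopp.symm
      (hfH u) (eventually_germ_of_forall (hgH u))
    exact ⟨u, k, e, he, hk, hfe, hge⟩
  by_contra! hcon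
  obtain ⟨j, hj, hpos⟩ := hcon
  set s := weylReflection Λ P j with hs
  set u' := u * s⁻¹ with hu'
  -- a regular point of the panel
  classical
  obtain ⟨m, hm⟩ := hB.exists_coroot_eq fun i => if i = j then 0 else 1
  obtain ⟨b, hb, hmb⟩ := exists_forall_tmul_of_eventually ((hfH u).and (hfH u')) (m := m)
    fun i hi => by rw [hm i hi]; split_ifs <;> norm_num
  obtain ⟨hb1, hb2⟩ := hmb b hb.le le_rfl
  set c₀ : ModelSpace Λ P := m ⊗ₜ b with hc₀
  have hc₀j : corootEval Λ P j c₀ = 0 := by rw [hc₀, corootEval_tmul, hm j hj, if_pos rfl, zero_smul]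
  have hsc₀ : s⁻¹ • c₀ = c₀ := by
    rw [inv_smul_eq_iff]; exact (weylReflection_smul_of_eq_zero P hc₀j).symm
  have hagree : Agree (H u) (H u') := agree_of_forall (p := p) (w := w') hB hA h2 (hH u) (hH u')
    fun c hc => by rw [← hgH u c hc, ← hgH u' c hc]
  have hpE : H u p = H u' p := by rw [← hHp, ← hHp]
  have hconv := hagree.isModelConvex h2 (hH u) (hH u') hpE
  have hpanel : H u (p + K u • c₀) = H u' (p + K u • c₀) := by
    refine hagree _ ⟨p + K u' • c₀, ?_⟩
    rw [← hb1, ← hb2, hu', mul_smul, hsc₀]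
  -- the apartments of `H u` and `H u'` share the chamber germ on the side of `g`
  obtain ⟨μ, hμ, hμb⟩ := exists_forall_rho_of_eventually hB
    (eventually_germ_dist_lt (P := P) (B := B) hb)
  -- Moving from the panel point `c₀` in the direction of the chamber of `g` makes coroot `j`
  -- positive; the others stay positive because `μ` is small compared with `b`.
  have hreg : ∀ i ∈ B, 0 < corootEval Λ P i (c₀ + (K u)⁻¹ • w' • rho hB μ) := by
    intro i hi
    rw [map_add]
    by_cases hij : i = j
    · subst hij
      rw [hc₀j, zero_add]
      obtain ⟨σ, hσ⟩ := corootEval_smul_perm P ((K u)⁻¹ * w')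
      rw [← mul_smul, hσ] at hpos ⊢
      exact (corootEval_nonneg_of_pos hB (rho_regular hB hμ)
        ((corootEval_nonneg_of_pos hB (rho_regular hB ha) hpos.le).2 _
          (rho_mem_fundChamber hB hμ.le))).1
    · rw [hc₀, corootEval_tmul, hm i hi, if_neg hij, one_smul]
      have h := (abs_corootEval_le_modelDist i ((K u)⁻¹ • w' • rho hB μ))
      rw [modelDist_zero_smul, modelDist_zero_smul] at h
      exact neg_lt_iff_pos_add'.1 (abs_lt.1 (h.trans_lt (hμb μ hμ.le le_rfl))).1
  have hmem := hconv.chamber_mem_of_parallel hB w' hpanel (q := p)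
    (fun c hc => by change H u _ = H u' _; rw [← hgH u c hc, ← hgH u' c hc])
    (rho_mem_fundChamber hB hμ.le)
  have hgerm := hconv.eventually_mem hB (K u) hpE (c := c₀ + (K u)⁻¹ • w' • rho hB μ)
    (by rwa [smul_add, smul_inv_smul, ← add_assoc]) hreg
  -- The apartment of `H u'` now contains both adjacent germs of `f`, so a single `t` gives both `K
  -- u` and `K u'`, and these differ by the reflection `s`.
  obtain ⟨t, ht⟩ := exists_transition hA h2 hf (hH u') (hp.trans (hHp u'))
  have ht1 : K u = t * u := eq_of_eventually_smul_eq hB <| by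
    filter_upwards [hgerm, hfH u] with c hc hfc
    have hc' : H u (p + K u • c) = H u' (p + K u • c) := hc
    rw [hc'] at hfc
    have := ht (u • c) ⟨_, hfc.symm⟩
    rw [hfc] at this
    rw [mul_smul]
    exact add_left_cancel (hA.1 _ (hH u') this)
  have ht2 : K u' = t * u' := eq_of_eventually_smul_eq hB <| by
    filter_upwards [hfH u'] with c hfc
    have := ht (u' • c) ⟨_, hfc.symm⟩
    rw [hfc] at this
    rw [mul_smul]
    exact add_left_cancel (hA.1 _ (hH u') this)
  have hK : (K u')⁻¹ = s * (K u)⁻¹ := by rw [ht2, ht1, hu']; group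
  have := hu u'
  rw [hK, mul_smul, hψ j hj] at this
  exact absurd hpos (not_lt.2 (by simpa using this))

/-- Every point lies in a common apartment with a subchamber of a given chamber. -/
theorem exists_chart_subchamber_point [Nontrivial Λ] (hB : IsRootBasis P B) (hA : IsModeled P A)
    (h1 : A1 P T A) (h2 : A2 P T A) (h3 : A3 P A) (hGG : GG P B A) (hCO : CO P B A) (hf : f ∈ A)
    (w : sphericalWeyl Λ P) (y : X) :
    ∃ p, ∃ h ∈ A, (∀ c ∈ fundChamber P B, f (p + w • c) = h (p + w • c)) ∧ y ∈ Set.range h := by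
  have key : ∀ p, ∃ u : sphericalWeyl Λ P, ∃ h ∈ A, ∃ a,
      (∀ c ∈ fundChamber P B, f (p + u • c) = h (p + u • c)) ∧ h a = y ∧
        u⁻¹ • (p - a) ∈ fundChamber P B := by
    intro p
    obtain ⟨_, ⟨g₀, hg₀, rfl⟩, hx, hy⟩ := h3 (f p) y
    obtain ⟨g, hg, hr, hfg⟩ := exists_agree_of_mem hA h1 h2 hf hg₀ hx
    rw [← hr] at hx hy
    obtain ⟨a, rfl⟩ := hy
    obtain ⟨v, hv⟩ := exists_inv_smul_mem_fundChamber (Λ := Λ) hB (a - p)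
    obtain ⟨u, k, h, hh, huk, hfh, hgh⟩ :=
      exists_opp_chamber hB hA h1 h2 hGG hCO hf hg (hfg p hx) v
    refine ⟨u, h, hh, p + k • v⁻¹ • (a - p), hfh, ?_, ?_⟩
    · rw [← hgh _ hv, smul_inv_smul, add_sub_cancel]
    · have := (huk.symm (k • v⁻¹ • (a - p))).1 (by rwa [inv_smul_smul])
      rwa [← smul_neg, neg_eq_zero_sub, ← sub_self p, sub_sub] at this
  choose U H hH a hfH hy hUa using key
  -- Parallel chambers of `f` share a subchamber on which both charts equal `f`. So the charts
  -- agree, and they place `y` at the same point.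
  have huniq : ∀ p q, U p = U q → a p = a q := by
    intro p q hpq
    obtain ⟨c, hc, c', hc', hcc⟩ := exists_add_smul_eq hB (U p) p q
    have hagree : Agree (H p) (H q) := by
      refine agree_of_forall (p := p + U p • c) (w := U p) hB hA h2 (hH p) (hH q) fun d hd => ?_
      have e1 := hfH p _ (add_mem_fundChamber hc hd)
      have e2 := hfH q _ (add_mem_fundChamber hc' hd)
      rw [smul_add, ← add_assoc] at e1 e2
      rw [← hpq, ← hcc] at e2
      rw [← e1, ← e2]
    have := hagree (a p) ⟨a q, by rw [hy, hy]⟩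
    rw [hy, ← hy q] at this
    exact (hA.1 _ (hH q) this).symm
  -- Thus `a` takes only finitely many values, indexed by the Weyl group. The value of `invFun`
  -- outside the range of `U` is harmless.
  have hloc : ∀ p, a p = a (Function.invFun U (U p)) := fun p =>
    huniq _ _ (Function.invFun_eq ⟨p, rfl⟩).symm
  choose μ hμ0 hμ using fun u : sphericalWeyl Λ P =>
    exists_forall_add_rho_regular hB (-(w⁻¹ • a (Function.invFun U u)))
  have := Fintype.ofFinite (sphericalWeyl Λ P)
  -- The sum of the positive thresholds exceeds each of them, so `p` lies deep in direction `w` as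
  -- seen from every possible `a`. Then `p - a p` is regular in direction `w` and also lies in
  -- direction `U p`, which forces the two chambers to coincide.
  set p := w • rho hB (∑ u, μ u) with hp
  have hreg : ∀ j ∈ B, 0 < corootEval Λ P j (w⁻¹ • (p - a p)) := by
    have := hμ (U p) (∑ u, μ u)
      (Finset.single_le_sum (f := μ) (fun u _ => (hμ0 u).le) (Finset.mem_univ _))
    rwa [← hloc, neg_add_eq_sub, ← inv_smul_smul w (rho hB _), ← hp, ← smul_sub] at this
  have hUw := smul_mem_fundChamber_iff hB (v := (U p)⁻¹ * w) hreg
    (by rw [mul_smul, smul_inv_smul]; exact hUa p)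
  refine ⟨p, H p, hH p, fun c hc => ?_, _, hy p⟩
  have := hfH p _ ((hUw c).2 hc)
  rwa [mul_smul, smul_inv_smul] at this

/-- For each `q` in the apartment of the second chamber, an apartment is built that contains a
subchamber of the first chamber and a chamber of `g` at `q` in the opposite direction. Only finitely
many such apartments arise, so one of them contains points of the second chamber cofinally along a
regular ray. -/
theorem A4_of_A3 (hB : IsRootBasis P B) (hA : IsModeled P A)
    (h1 : A1 P T A) (h2 : A2 P T A) (h3 : A3 P A) (hGG : GG P B A) (hCO : CO P B A) :
    A4 P B A := by
  rintro S S' ⟨x, hS⟩ ⟨y, hS'⟩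
  obtain ⟨-, -, ⟨ε, hε, -⟩, -⟩ := hGG x S S hS hS
  have : Nontrivial Λ := ⟨⟨ε, 0, hε.ne'⟩⟩
  obtain ⟨f, hf, p, w, -, rfl⟩ := hS.exists_eq
  obtain ⟨g, hg, p', w', -, rfl⟩ := hS'.exists_eq
  have key : ∀ q, ∃ u k : sphericalWeyl Λ P, ∃ e ∈ A, ∃ r p₁, Opp B u k ∧
      (∀ c ∈ fundChamber P B, g (q + u • c) = e (q + u • c)) ∧
      (∃ c ∈ fundChamber P B, p₁ = p + w • c) ∧
      ∀ c ∈ fundChamber P B, f (p₁ + w • c) = e (r + k • c) := by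
    intro q
    obtain ⟨b, h, hh, hfh, ⟨b', hb'⟩⟩ :=
      exists_chart_subchamber_point hB hA h1 h2 h3 hGG hCO hf w (g q)
    obtain ⟨m, h', hh', -, hhh', -⟩ := exists_agree hA h1 h2 hg hh hb'.symm
    obtain ⟨u, k, e, he, huk, hge, hhe⟩ := exists_opp_chamber hB hA h1 h2 hGG hCO hg hh'
      (p := q) (by rw [← hb']; simpa using (hhh' 0).symm) (m⁻¹ * w)
    -- In the chart `h`, the subchamber at `b` and the chamber at `b'`, the position of `g q`, are
    -- parallel and so share a subchamber. Intersecting once more with the chamber at `p` puts it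
    -- inside `S`.
    obtain ⟨c₁, hc₁, c₂, hc₂, h12⟩ := exists_add_smul_eq hB w b b'
    obtain ⟨c₃, hc₃, c₄, hc₄, h34⟩ := exists_add_smul_eq hB w (b + w • c₁) p
    refine ⟨u, k, e, he, q + k • (c₂ + c₃), p + w • c₄, huk, hge, ⟨c₄, hc₄, rfl⟩, fun c hc => ?_⟩
    have e1 := hfh (c₁ + c₃ + c) (add_mem_fundChamber (add_mem_fundChamber hc₁ hc₃) hc)
    have e2 := hhe (c₂ + c₃ + c) (add_mem_fundChamber (add_mem_fundChamber hc₂ hc₃) hc)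
    rw [hhh', mul_smul, smul_inv_smul] at e2
    simp only [smul_add, ← add_assoc] at e1 e2 ⊢
    rw [h34] at e1
    rw [← h12, h34] at e2
    rw [e1, e2]
  choose U K E hE r p₁ hopp hgE hp₁ hfE using key
  have huniq : ∀ q q', U q = U q' → K q = K q' → E q = E q' := by
    intro q q' hU hK
    obtain ⟨c, hc, c', hc', hcc⟩ := exists_add_smul_eq hB (U q) q q'
    have hEE : ∀ d ∈ fundChamber P B,
        E q (q + U q • c + U q • d) = E q' (q + U q • c + U q • d) := by
      intro d hd
      have e1 := hgE q _ (add_mem_fundChamber hc hd)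
      have e2 := hgE q' _ (add_mem_fundChamber hc' hd)
      rw [smul_add, ← add_assoc] at e1 e2
      rw [← hU, ← hcc] at e2
      rw [← e1, ← e2]
    have hagree : Agree (E q) (E q') := agree_of_forall hB hA h2 (hE q) (hE q') hEE
    have hq : E q (q + U q • c) = E q' (q + U q • c) := by simpa using hEE 0 zero_mem_fundChamber
    have hconv := hagree.isModelConvex h2 (hE q) (hE q') hq
    obtain ⟨d, hd, d', hd', hdd⟩ := exists_add_smul_eq hB w (p₁ q) (p₁ q')
    have hz : ∀ b ∈ fundChamber P B,
        E q (r q + K q • d + K q • b) = E q' (r q' + K q • d' + K q • b) := by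
      intro b hb
      have e1 := hfE q _ (add_mem_fundChamber hd hb)
      have e2 := hfE q' _ (add_mem_fundChamber hd' hb)
      rw [smul_add, smul_add, ← add_assoc, ← add_assoc] at e1 e2
      rw [← hK, ← hdd] at e2
      rw [← e1, ← e2]
    -- Both charts send these model points to the same point of the first chamber, and the charts
    -- agree on common points.
    have hz0 : r q + K q • d = r q' + K q • d' := by
      have e0 := hz 0 zero_mem_fundChamber
      simp only [smul_zero, add_zero] at e0
      have := hagree _ ⟨_, e0.symm⟩
      rw [e0] at this
      exact (hA.1 _ (hE q') this).symm
    rw [← hz0] at hz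
    -- The common part contains a chamber in direction `U q` and, by convexity, the one in the
    -- opposite direction `K q` at the same point. The uniqueness in (CO) identifies the apartments.
    have hr := hCO.range_eq hA h2 (hE q) (hE q') (hopp q) hEE fun b hb =>
      hconv.chamber_mem_of_parallel hB (K q) hq hz hb
    funext z
    exact hagree z (hr ▸ ⟨z, rfl⟩)
  -- one apartment contains arbitrarily far points of a regular ray in `S'`
  set Q : Λ → ModelSpace Λ P := fun a => p' + w' • rho hB a with hQ
  obtain ⟨t, ht⟩ : ∃ t, ∀ a₀ : Λ, ∃ a, a₀ ≤ a ∧ (U (Q a), K (Q a)) = t := by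
    by_contra! hcon
    choose a₀ ha₀ using hcon
    have := Fintype.ofFinite (sphericalWeyl Λ P)
    refine ha₀ (U (Q (∑ t, |a₀ t|)), K (Q (∑ t, |a₀ t|))) (∑ t, |a₀ t|) ?_ rfl
    exact (le_abs_self _).trans (Finset.single_le_sum (f := fun t => |a₀ t|)
      (fun _ _ => abs_nonneg _) (Finset.mem_univ _))
  -- The bound `0 ≤ a` keeps `Q a` inside the second chamber, so the chamber based there is a
  -- subchamber.
  obtain ⟨a, ha, hat⟩ := ht 0
  have hmem : ∀ q, g q = E q q := fun q => by simpa using hgE q 0 zero_mem_fundChamber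
  have hagree : Agree g (E (Q a)) := agree_of_forall hB hA h2 hg (hE _) (hgE (Q a))
  have hconv := hagree.isModelConvex h2 hg (hE _) (hmem (Q a))
  have hsub : ∀ c ∈ fundChamber P B, g (Q a + w' • c) = E (Q a) (Q a + w' • c) := by
    intro c hc
    refine hconv.chamber_mem_of_ray hB w' (hmem (Q a)) (x := -rho hB a) (fun a₀ => ?_) hc
    obtain ⟨a₁, ha₁, ht₁⟩ := ht a₀
    refine ⟨a₁, ha₁, ?_⟩
    have e1 : Q a + w' • (-rho hB a + rho hB a₁) = Q a₁ := by
      simp only [hQ, smul_add, smul_neg]; abel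
    obtain ⟨hU, hK⟩ := Prod.ext_iff.1 (hat.trans ht₁.symm)
    rw [e1, huniq _ _ hU hK]
    exact hmem (Q a₁)
  obtain ⟨c₀, hc₀, hpc⟩ := hp₁ (Q a)
  refine ⟨f '' chamber P B (p₁ (Q a)) w, g '' chamber P B (Q a) w', ⟨_, isChamberAt_image hf⟩, ?_,
    ⟨_, isChamberAt_image hg⟩, ?_, _, ⟨_, hE (Q a), rfl⟩, ?_, ?_⟩
  · refine image_chamber_subset_iff.2 fun c hc => mem_image_chamber.2
      ⟨c₀ + c, add_mem_fundChamber hc₀ hc, ?_⟩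
    rw [hpc, smul_add, add_assoc]
  · refine image_chamber_subset_iff.2 fun c hc => mem_image_chamber.2
      ⟨rho hB a + c, add_mem_fundChamber (rho_mem_fundChamber hB ha) hc, ?_⟩
    rw [smul_add, ← add_assoc]
  · exact image_chamber_subset_iff.2 fun c hc => ⟨_, (hfE (Q a) c hc).symm⟩
  · exact image_chamber_subset_iff.2 fun c hc => ⟨_, (hsub c hc).symm⟩

end Main

end

end AffineBuilding

theorem mainTheorem6 {F : Subfield ℝ} {ι M N Λ X : Type*} [Fintype ι]
    [AddCommGroup M] [Module F M] [AddCommGroup N] [Module F N]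
    [AddCommGroup Λ] [LinearOrder Λ] [IsOrderedAddMonoid Λ]
    [Module F Λ] [IsStrictOrderedModule F Λ]
    (P : RootPairing ι F M N) [P.IsRootSystem]
    (B : Finset ι) (hB : AffineBuilding.IsRootBasis P B)
    (T : AddSubgroup (AffineBuilding.ModelSpace Λ P)) (hT : AffineBuilding.IsWeylInvariant P T)
    (A : Set (AffineBuilding.ModelSpace Λ P → X)) (hA : AffineBuilding.IsModeled P A)
    (h1 : AffineBuilding.A1 P T A) (h2 : AffineBuilding.A2 P T A) :
    ((AffineBuilding.A3 P A ∧ AffineBuilding.GG P B A ∧ AffineBuilding.CO P B A) ↔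
      (AffineBuilding.A3' P B A ∧ AffineBuilding.CO P B A)) ∧
    (AffineBuilding.A3 P A → AffineBuilding.GG P B A → AffineBuilding.CO P B A →
      AffineBuilding.A4 P B A) ∧
    (AffineBuilding.A3' P B A → AffineBuilding.CO P B A → AffineBuilding.A4 P B A) := by
  have hGG : AffineBuilding.A3' P B A → AffineBuilding.GG P B A :=
    fun h x S S' hS hS' => h x x S S' hS hS'
  refine ⟨⟨fun ⟨h3, hG, hCO⟩ => ⟨AffineBuilding.A3'_of_A3 hB hA h1 h2 h3 hG hCO, hCO⟩,
    fun ⟨h3, hCO⟩ => ⟨AffineBuilding.A3_of_A3' hA h3, hGG h3, hCO⟩⟩, fun h3 hG hCO => ?_,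
    fun h3 hCO => ?_⟩
  · exact AffineBuilding.A4_of_A3 hB hA h1 h2 h3 hG hCO
  · exact AffineBuilding.A4_of_A3 hB hA h1 h2 (AffineBuilding.A3_of_A3' hA h3) (hGG h3) hCO
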